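/- Theorem 4.1. For probability measures $P,Q$ on the same measurable space and $\alpha\ge 0$ let $H_\alpha(P\|Q)=\int \max\{\tfrac{dP}{dQ}-\alpha,0\}\,dQ$ be the hockey-stick divergence (if $P\not\ll Q$, the mass of the $Q$-singular part of $P$ is added). Fix positive integers $L_C,L_F$ (context and forecast length), a sequence length $L$ with $L-L_F+1\ge L_C+L_F$, a number $N$ of sequences, a batch size $\Lambda\ge 1$, a parameter dimension $D$, initial parameters $\theta_0\in\mathbb R^D$, a learning rate $\eta>0$, a noise scale $\sigma>0$ and a clipping norm $C>0$. Put $T=L-L_F+1$. A dataset is a set $x=\{x_1,\dots,x_N\}$ of $N$ distinct enumerated sequences in $\mathbb R^L$; $x,x'$ are neighboring ($x\simeq x'$) if they differ in exactly one pair $x_n,x_n'$, and $x_n,x'_n$ differ in exactly one time step. A model consists of functions $f_\theta:\mathbb R^{L_C}\to\mathbb R^{L_F}$ ($\theta\in\mathbb R^D$) and a loss $\mathcal L:\mathbb R^{L_F}\times\mathbb R^{L_F}\to\mathbb R$ such that $\theta\mapsto\mathcal L(f_\theta(c),y)$ is differentiable for all $c,y$. For an integer $1\le\lambda\le\Lambda$,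 the epoch mechanism with deterministic top-level iteration performs $K=\lfloor N\lambda/\Lambda\rfloor$ training steps, starting at $\theta_0$. With $N'=\lfloor\Lambda/\lambda\rfloor$, step $b\in\{1,\dots,K\}$ uses the sequences $x_n$ with $(b-1)N'<n\le bN'$. For each of them, independently, it samples a multiset of start indices in $\{1,\dots,T\}$ by one of two bottom-level schemes: *Poisson sampling* (each index is included independently with probability $\min\{1,\lambda/T\}$) or *sampling with replacement* ($\lambda$ independent uniform indices). Every sampled index $t$ yields the subsequence of length $L_C+L_F$ that starts at position $t$ of $x_n$ after $L_C$ zeros have been prepended to $x_n$; its first $L_C$ entries are the context $c$, its last $L_F$ entries the target $y$, and its gradient $g=\nabla_\theta\mathcal L(f_\theta(c),y)$ at the current parameters is clipped to $g/\max\{1,\|g\|_2/C\}$. The step computes the noisy gradient $\tilde g_b=\frac1\Lambda\big(\sum \text{clipped gradients}+Z_b\big)$ with fresh independent $Z_b\sim\mathcal N(0,\sigma^2C^2 I)$, and replaces $\theta$ by $\theta-\eta\tilde g_b$. The output of the epoch is $(\tilde g_1,\dots,\tilde g_K)\in\mathbb R^{K\times D}$; its distribution on the dataset $x$ with the model $m=(f,\mathcal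 L)$ is denoted $M^{(\lambda)}_{m,x}$. Probability distributions $(P,Q)$ on a common measurable space are a tight dominating pair of the epoch mechanism with parameter $\lambda$ if $\sup_{m}\sup_{x\simeq x'}H_\alpha(M^{(\lambda)}_{m,x}\|M^{(\lambda)}_{m,x'})=H_\alpha(P\|Q)$ for all $\alpha\ge 0$. Fix either of the two bottom-level schemes and let $(P^*(\lambda),Q^*(\lambda))$ be a tight dominating pair of the epoch mechanism with parameter $\lambda$, for every $\lambda\in\{1,\dots,\Lambda\}$. Then, for every $\alpha\ge 0$, $H_\alpha(P^*(\lambda)\|Q^*(\lambda))$ is minimized over $\lambda\in\{1,\dots,\Lambda\}$ at $\lambda=1$. -/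

import Mathlib

open MeasureTheory ProbabilityTheory
open scoped ENNReal NNReal

noncomputable section

namespace StructuredSubsampling

/-! ### Hockey-stick divergence and dominating pairs -/

/-- The hockey-stick divergence `H_α(P ‖ Q) = ∫ max {dP/dQ - α, 0} dQ`, where the part of `P` that
is singular with respect to `Q` (on which `dP/dQ = ∞`) contributes its whole mass. For `P ≪ Q` the
second summand is `0`. (Subtraction in `ℝ≥0∞` is truncated at `0`.) -/
def hockeyStick {O : Type*} [MeasurableSpace O] (α : ℝ≥0) (P Q : Measure O) : ℝ≥0∞ :=
  (∫⁻ o, (P.rnDeriv Q o - (α : ℝ≥0∞)) ∂Q) + P.singularPart Q Set.univ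

/-- The privacy profile `α ↦ sup_{x ≃ x'} H_α(M_x ‖ M_{x'})` of a mechanism `M` under the neighboring
relation `R`. The mechanism may depend on a parameter `i : ι` about which nothing is assumed, so that
the supremum is also over `i`; both datasets are processed with the same parameter. -/
def privacyProfile {ι X O : Type*} [MeasurableSpace O] (M : ι → X → Measure O)
    (R : X → X → Prop) (α : ℝ≥0) : ℝ≥0∞ :=
  ⨆ (i : ι) (x : X) (x' : X) (_ : R x x'), hockeyStick α (M i x) (M i x')

/-- The probability distributions `(P, Q)` are a tight dominating pair for the mechanism `M` under the
neighboring relation `R`. -/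
def IsTightDominatingPair {ι X O Ω : Type*} [MeasurableSpace O] [MeasurableSpace Ω]
    (M : ι → X → Measure O) (R : X → X → Prop) (P Q : Measure Ω) : Prop :=
  IsProbabilityMeasure P ∧ IsProbabilityMeasure Q ∧
    ∀ α : ℝ≥0, privacyProfile M R α = hockeyStick α P Q

/-! ### Datasets of time series -/

/-- A dataset: a set of `N` time series of length `L`, with an enumeration `x_1, …, x_N`. -/
abbrev Dataset (N L : ℕ) : Type := Fin N ↪ (Fin L → ℝ)

/-- `1`-event-level neighboring datasets: they differ in a single pair of sequences, and these two
sequences differ in a single time step. -/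
def EventNeighboring {N L : ℕ} (x x' : Dataset N L) : Prop :=
  ∃ (n : Fin N) (t : Fin L), x n t ≠ x' n t ∧ (∀ s, s ≠ t → x n s = x' n s) ∧
    ∀ m, m ≠ n → x m = x' m

/-- The sequence `a`, preceded by `LC` zeros (positions are counted from `0`). -/
def prependZeros {L : ℕ} (LC : ℕ) (a : Fin L → ℝ) (s : ℕ) : ℝ :=
  if h : LC ≤ s ∧ s - LC < L then a ⟨s - LC, h.2⟩ else 0

/-- The number `T = L - LF + 1` of start indices of subsequences (used for `LF ≤ L`). -/
abbrev numStarts (L LF : ℕ) : ℕ := L - LF + 1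

/-- Context window (first `LC` entries) of the length-`(LC + LF)` subsequence of the zero-padded
sequence that starts at position `t`. -/
def contextWindow {L : ℕ} (LC : ℕ) (a : Fin L → ℝ) (t : ℕ) : Fin LC → ℝ :=
  fun i => prependZeros LC a (t + i)

/-- Forecast window (last `LF` entries) of the length-`(LC + LF)` subsequence of the zero-padded
sequence that starts at position `t`. -/
def forecastWindow {L : ℕ} (LC LF : ℕ) (a : Fin L → ℝ) (t : ℕ) : Fin LF → ℝ :=
  fun j => prependZeros LC a (t + LC + j)

/-! ### Bottom-level sampling: the multiset of sampled start indices of one sequence -/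

/-- The two bottom-level sampling schemes. -/
inductive BottomLevel
  | poisson
  | withReplacement

/-- Poisson sampling at rate `r`: every element of `Fin T` is included independently with
probability `r`. -/
def poissonSubset (T : ℕ) (r : ℝ≥0) (hr : r ≤ 1) : PMF (Finset (Fin T)) :=
  PMF.ofFintype (fun S => ∏ t : Fin T, if t ∈ S then (r : ℝ≥0∞) else 1 - (r : ℝ≥0∞)) <| by
    have h1 : (r : ℝ≥0∞) + (1 - (r : ℝ≥0∞)) = 1 :=
      add_tsub_cancel_of_le (by exact_mod_cast hr)
    have h2 := Finset.prod_add (fun _ : Fin T => (r : ℝ≥0∞)) (fun _ => 1 - (r : ℝ≥0∞)) Finset.univ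
    simp only [h1, Finset.prod_const_one, Finset.powerset_univ] at h2
    refine Eq.trans ?_ h2.symm
    refine Finset.sum_congr rfl fun S _ => ?_
    rw [← Finset.prod_mul_prod_compl S, ← Finset.compl_eq_univ_sdiff]
    congr 1
    · exact Finset.prod_congr rfl fun t ht => by simp [ht]
    · exact Finset.prod_congr rfl fun t ht => by simp [Finset.mem_compl.mp ht]

/-- The distribution of the multiset of sampled start indices, for `T` available start indices and
`lam` (expected) subsequences. -/
def BottomLevel.sample (T : ℕ) [NeZero T] (lam : ℕ) : BottomLevel → PMF (Multiset (Fin T))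
  | .poisson =>
      (poissonSubset T (min 1 ((lam : ℝ≥0) / (T : ℝ≥0))) (min_le_left _ _)).map Finset.val
  | .withReplacement =>
      (PMF.uniformOfFintype (Fin lam → Fin T)).map fun τ => Finset.univ.val.map τ

/-- Multisets of start indices carry the discrete σ-algebra. -/
instance instMeasurableSpaceMultisetFin (T : ℕ) : MeasurableSpace (Multiset (Fin T)) := ⊤

instance instDiscreteMeasurableSpaceMultisetFin (T : ℕ) :
    DiscreteMeasurableSpace (Multiset (Fin T)) := ⟨fun _ => trivial⟩

/-! ### The model -/

/-- The space of model parameters and of gradients. -/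
abbrev Params (D : ℕ) : Type := EuclideanSpace ℝ (Fin D)

/-- A parametric forecasting model `f_θ` with a loss, such that the loss of every forecast is
differentiable in the parameters `θ`. -/
structure ForecastModel (D LC LF : ℕ) where
  /-- the forecast `f_θ(y_C)` -/
  predict : Params D → (Fin LC → ℝ) → (Fin LF → ℝ)
  /-- the loss of a forecast, given the true values -/
  loss : (Fin LF → ℝ) → (Fin LF → ℝ) → ℝ
  differentiable : ∀ c y, Differentiable ℝ fun θ => loss (predict θ c) y

/-- The gradient `∇_θ loss(f_θ(c), y)`. -/
def ForecastModel.grad {D LC LF : ℕ} (m : ForecastModel D LC LF) (θ : Params D)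
    (c : Fin LC → ℝ) (y : Fin LF → ℝ) : Params D :=
  gradient (fun θ' => m.loss (m.predict θ' c) y) θ

/-- Gradient clipping `g / max {1, ‖g‖₂ / C}`. -/
def clip {D : ℕ} (C : ℝ) (g : Params D) : Params D :=
  (max 1 (‖g‖ / C))⁻¹ • g

/-! ### The epoch mechanism -/

/-- Public inputs of a training epoch, apart from the data, the model and the (expected) number `lam`
of subsequences per sequence. -/
structure EpochConfig where
  /-- number of sequences -/
  N : ℕ
  /-- length of the sequences -/
  L : ℕ
  /-- context length -/
  LC : ℕ
  /-- forecast length -/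
  LF : ℕ
  /-- number of model parameters -/
  D : ℕ
  /-- (expected) batch size -/
  batchSize : ℕ
  /-- noise scale -/
  σ : ℝ
  /-- clipping norm -/
  C : ℝ
  /-- learning rate -/
  η : ℝ
  /-- initial parameters -/
  θ₀ : Params D

namespace EpochConfig

variable (cfg : EpochConfig) (lam : ℕ)

/-- The number `T` of start indices. -/
abbrev T : ℕ := numStarts cfg.L cfg.LF

/-- The number `⌊N * lam / Λ⌋` of training steps in an epoch, where `Λ` is the batch size. -/
def numSteps : ℕ := cfg.N * lam / cfg.batchSize

/-- The number `N' = ⌊Λ / lam⌋` of sequences per batch, where `Λ` is the batch size. -/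
def seqsPerBatch : ℕ := cfg.batchSize / lam

theorem index_lt {lam : ℕ} (b : Fin (cfg.numSteps lam)) (j : Fin (cfg.seqsPerBatch lam)) :
    b * cfg.seqsPerBatch lam + j < cfg.N := by
  have hb := b.2
  have hj := j.2
  have hlam : 0 < lam := by
    rcases Nat.eq_zero_or_pos lam with h | h
    · subst h
      simp [numSteps] at hb
    · exact h
  have h1 : (b : ℕ) * cfg.seqsPerBatch lam + j < cfg.numSteps lam * cfg.seqsPerBatch lam := by
    calc (b : ℕ) * cfg.seqsPerBatch lam + j
        < (b : ℕ) * cfg.seqsPerBatch lam + cfg.seqsPerBatch lam := by omega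
      _ = ((b : ℕ) + 1) * cfg.seqsPerBatch lam := by ring
      _ ≤ _ := Nat.mul_le_mul_right _ hb
  refine lt_of_lt_of_le h1 (Nat.le_of_mul_le_mul_right ?_ hlam)
  calc cfg.numSteps lam * cfg.seqsPerBatch lam * lam
      = cfg.numSteps lam * (cfg.batchSize / lam * lam) := by rw [seqsPerBatch, mul_assoc]
    _ ≤ cfg.numSteps lam * cfg.batchSize := Nat.mul_le_mul_left _ (Nat.div_mul_le_self _ _)
    _ ≤ cfg.N * lam := Nat.div_mul_le_self _ _

/-- Deterministic top-level iteration: the index of the `j`-th sequence in the `b`-th batch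
(everything counted from `0`). -/
def topLevel {lam : ℕ} (b : Fin (cfg.numSteps lam)) (j : Fin (cfg.seqsPerBatch lam)) : Fin cfg.N :=
  ⟨b * cfg.seqsPerBatch lam + j, cfg.index_lt b j⟩

/-- The randomness of one training step: the sampled start indices of every sequence in the batch,
and a standard Gaussian vector. -/
abbrev StepRandomness : Type :=
  (Fin (cfg.seqsPerBatch lam) → Multiset (Fin cfg.T)) × Params cfg.D

/-- The distribution of the randomness of one training step. -/
def stepRandomnessLaw (S : BottomLevel) : Measure (cfg.StepRandomness lam) :=
  (Measure.pi fun _ => (S.sample cfg.T lam).toMeasure).prod (stdGaussian (Params cfg.D))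

variable {lam}

/-- The noisy gradient `Λ⁻¹ (∑ clipped gradients of the sampled subsequences + 𝒩(0, σ² C² I))` of the
`b`-th training step at the parameters `θ`, as a function of the step's randomness `ω`. -/
def noisyGradient (m : ForecastModel cfg.D cfg.LC cfg.LF) (x : Dataset cfg.N cfg.L)
    (b : Fin (cfg.numSteps lam)) (θ : Params cfg.D) (ω : cfg.StepRandomness lam) : Params cfg.D :=
  (1 / (cfg.batchSize : ℝ)) •
    ((∑ j : Fin (cfg.seqsPerBatch lam), ((ω.1 j).map fun t : Fin cfg.T =>
        clip cfg.C (m.grad θ (contextWindow cfg.LC (x (cfg.topLevel b j)) t)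
          (forecastWindow cfg.LC cfg.LF (x (cfg.topLevel b j)) t))).sum)
      + (cfg.σ * cfg.C) • ω.2)

/-- The model parameters after `k` training steps, as a function of the epoch's randomness. -/
def iterate (m : ForecastModel cfg.D cfg.LC cfg.LF) (x : Dataset cfg.N cfg.L)
    (ω : Fin (cfg.numSteps lam) → cfg.StepRandomness lam) : ℕ → Params cfg.D
  | 0 => cfg.θ₀
  | k + 1 =>
    if h : k < cfg.numSteps lam then
      iterate m x ω k - cfg.η • cfg.noisyGradient m x ⟨k, h⟩ (iterate m x ω k) (ω ⟨k, h⟩)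
    else iterate m x ω k

/-- The output of the epoch (learning without hidden states): the noisy gradients used in all its
training steps. -/
def output (m : ForecastModel cfg.D cfg.LC cfg.LF) (x : Dataset cfg.N cfg.L)
    (ω : Fin (cfg.numSteps lam) → cfg.StepRandomness lam) : Fin (cfg.numSteps lam) → Params cfg.D :=
  fun b => cfg.noisyGradient m x b (cfg.iterate m x ω b) (ω b)

/-- The epoch mechanism: the distribution `M_x` of the output of an epoch on the dataset `x`, when
training the model `m` with bottom-level sampling scheme `S` and `lam` (expected) subsequences. All
the sampling and all the noise is independent. -/
def epoch (lam : ℕ) (S : BottomLevel) (m : ForecastModel cfg.D cfg.LC cfg.LF)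
    (x : Dataset cfg.N cfg.L) : Measure (Fin (cfg.numSteps lam) → Params cfg.D) :=
  (Measure.pi fun _ : Fin (cfg.numSteps lam) => cfg.stepRandomnessLaw lam S).map (cfg.output m x)

end EpochConfig

end StructuredSubsampling

end

/-!
Hockey-stick divergences are governed by tests: `H_α(P ‖ Q)` is the maximum of `P A - α Q A` over
the measurable sets `A`. A changed time step affects the gradients of one sequence in one training
step only, and only those of the subsequences containing it. Conditioning on all other randomness,
the privacy loss of an epoch is therefore at most that of the noisy sum of the clipped gradients of
one sequence, for gradients of norm at most `C` that agree at the start indices outside the set `A`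
of those covering the changed time step.

For `lam = 1`, this comparison of Gaussian mixtures is hardest in dimension one, with the gradients
`C` and `-C` inside `A` and a common value `k ∈ [-C, C]` outside. The optimal test is a half-line
`[τ, ∞)`: for two Gaussians whose weighted densities agree at `τ` this is the Neyman-Pearson lemma,
together with the monotonicity of the bound in the distance of the means; a difference of mixtures
whose total weighted densities agree at `τ` splits into pairs of this kind.

A larger `lam` only helps this test. Under Poisson sampling `k = 0`, and a higher rate adds
nonnegative terms to one sum and nonpositive ones to the other. Under sampling with replacement, the
threshold is moved by `(lam - 1) k`, and each of the additional gradients is at least `k` for one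
dataset and at most `k` for the other. Finally, a suitable model and pair of datasets attain these
one-dimensional gradients for every `lam`.
-/

noncomputable section

namespace StructuredSubsampling

/-! ### Testing against hockey-stick divergences -/

section HockeyStick

variable {O : Type*} [MeasurableSpace O] {α : ℝ≥0} {P Q : Measure O} [IsFiniteMeasure P]
  [IsFiniteMeasure Q]

theorem measure_le_hockeyStick_add (α : ℝ≥0) (P Q : Measure O) [IsFiniteMeasure P]
    [IsFiniteMeasure Q] {A : Set O} (hA : MeasurableSet A) :
    P A ≤ hockeyStick α P Q + α * Q A := by
  have hdensity : ∫⁻ o in A, P.rnDeriv Q o ∂Q ≤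
      (∫⁻ o, (P.rnDeriv Q o - (α : ℝ≥0∞)) ∂Q) + α * Q A :=
    calc ∫⁻ o in A, P.rnDeriv Q o ∂Q
        ≤ ∫⁻ o in A, ((P.rnDeriv Q o - (α : ℝ≥0∞)) + α) ∂Q :=
          lintegral_mono fun o => le_tsub_add
      _ = (∫⁻ o in A, (P.rnDeriv Q o - (α : ℝ≥0∞)) ∂Q) + α * Q A := by
          rw [lintegral_add_right _ measurable_const, setLIntegral_const]
      _ ≤ _ := by gcongr; exact Measure.restrict_le_self
  calc P A = P.singularPart Q A + ∫⁻ o in A, P.rnDeriv Q o ∂Q := by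
        rw [← withDensity_apply _ hA, ← Measure.add_apply, P.singularPart_add_rnDeriv Q]
    _ ≤ P.singularPart Q Set.univ +
        ((∫⁻ o, (P.rnDeriv Q o - (α : ℝ≥0∞)) ∂Q) + α * Q A) :=
        add_le_add (measure_mono (Set.subset_univ _)) hdensity
    _ = hockeyStick α P Q + α * Q A := by rw [hockeyStick]; ring

theorem exists_hockeyStick_add_eq (α : ℝ≥0) (P Q : Measure O) [IsFiniteMeasure P]
    [IsFiniteMeasure Q] :
    ∃ A, MeasurableSet A ∧ hockeyStick α P Q + α * Q A = P A := by
  obtain ⟨N, hN, hPN, hQN⟩ := Measure.mutuallySingular_singularPart P Q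
  set B : Set O := {o | (α : ℝ≥0∞) < P.rnDeriv Q o}
  have hB : MeasurableSet B := measurableSet_lt measurable_const (Measure.measurable_rnDeriv P Q)
  have hQB : (B ∪ Nᶜ : Set O) =ᵐ[Q] B := union_ae_eq_left_of_ae_eq_empty (ae_eq_empty.2 hQN)
  have hPB : P.singularPart Q (B ∪ Nᶜ) = P.singularPart Q Set.univ := by
    refine measure_congr (ae_eq_univ.2 (measure_mono_null ?_ hPN))
    rw [Set.compl_union, compl_compl]
    exact Set.inter_subset_right
  have hdensity : (∫⁻ o, (P.rnDeriv Q o - (α : ℝ≥0∞)) ∂Q) + α * Q B =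
      ∫⁻ o in B, P.rnDeriv Q o ∂Q :=
    calc (∫⁻ o, (P.rnDeriv Q o - (α : ℝ≥0∞)) ∂Q) + α * Q B
        = (∫⁻ o in B, (P.rnDeriv Q o - (α : ℝ≥0∞)) ∂Q) + ∫⁻ _ in B, α ∂Q := by
          rw [setLIntegral_const, setLIntegral_eq_of_support_subset fun o ho => ?_]
          exact tsub_pos_iff_lt.1 (pos_iff_ne_zero.2 ho)
      _ = ∫⁻ o in B, ((P.rnDeriv Q o - (α : ℝ≥0∞)) + α) ∂Q :=
          (lintegral_add_right _ measurable_const).symm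
      _ = ∫⁻ o in B, P.rnDeriv Q o ∂Q :=
          setLIntegral_congr_fun hB fun o ho => tsub_add_cancel_of_le (le_of_lt ho)
  refine ⟨B ∪ Nᶜ, hB.union hN.compl, ?_⟩
  calc hockeyStick α P Q + α * Q (B ∪ Nᶜ)
      = P.singularPart Q Set.univ + ((∫⁻ o, (P.rnDeriv Q o - (α : ℝ≥0∞)) ∂Q) + α * Q B) := by
        rw [hockeyStick, measure_congr hQB]; ring
    _ = P.singularPart Q (B ∪ Nᶜ) + ∫⁻ o in B ∪ Nᶜ, P.rnDeriv Q o ∂Q := by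
        rw [hdensity, hPB, setLIntegral_congr hQB]
    _ = P (B ∪ Nᶜ) := by
        rw [← withDensity_apply _ (hB.union hN.compl), ← Measure.add_apply,
          P.singularPart_add_rnDeriv Q]

theorem hockeyStick_le_iff {c : ℝ≥0∞} :
    hockeyStick α P Q ≤ c ↔ ∀ A, MeasurableSet A → P A ≤ c + α * Q A := by
  refine ⟨fun h A hA => (measure_le_hockeyStick_add α P Q hA).trans (by gcongr), fun h => ?_⟩
  obtain ⟨A, hA, heq⟩ := exists_hockeyStick_add_eq α P Q
  have hfin : (α : ℝ≥0∞) * Q A ≠ ∞ := ENNReal.mul_ne_top ENNReal.coe_ne_top (measure_ne_top _ _)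
  exact (ENNReal.add_le_add_iff_right hfin).1 (heq.trans_le (h A hA))

theorem hockeyStick_map_le {O' : Type*} [MeasurableSpace O'] {f : O → O'} (hf : Measurable f) :
    hockeyStick α (P.map f) (Q.map f) ≤ hockeyStick α P Q := by
  refine hockeyStick_le_iff.2 fun A hA => ?_
  rw [Measure.map_apply hf hA, Measure.map_apply hf hA]
  exact measure_le_hockeyStick_add α P Q (hf hA)

theorem hockeyStick_le_hockeyStick {O' : Type*} [MeasurableSpace O'] {P' Q' : Measure O'}
    [IsFiniteMeasure P'] [IsFiniteMeasure Q']
    (h : ∀ A, MeasurableSet A → ∃ A', MeasurableSet A' ∧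
      P.real A - α * Q.real A ≤ P'.real A' - α * Q'.real A') :
    hockeyStick α P Q ≤ hockeyStick α P' Q' := by
  refine hockeyStick_le_iff.2 fun A hA => ?_
  obtain ⟨A', hA', hle⟩ := h A hA
  have htop : hockeyStick α P' Q' ≠ ∞ := by
    obtain ⟨B, -, hB⟩ := exists_hockeyStick_add_eq α P' Q'
    exact (le_self_add.trans_lt (hB.trans_lt (measure_lt_top P' B))).ne
  have hdual := ENNReal.toReal_mono (by finiteness) (measure_le_hockeyStick_add α P' Q' hA')
  rw [ENNReal.toReal_add htop (by finiteness)] at hdual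
  rw [← ENNReal.toReal_le_toReal (by finiteness) (by finiteness), ENNReal.toReal_add htop
    (by finiteness)]
  simp only [ENNReal.toReal_mul, ENNReal.coe_toReal, ← measureReal_def] at hdual ⊢
  linarith

theorem hockeyStick_self_le (α : ℝ≥0) (P : Measure O) [IsProbabilityMeasure P] :
    hockeyStick α P P ≤ 1 - α := by
  refine hockeyStick_le_iff.2 fun A _ => ?_
  calc P A ≤ (1 - α + α) * P A := le_mul_of_one_le_left' le_tsub_add
    _ = (1 - α) * P A + α * P A := add_mul _ _ _
    _ ≤ 1 - α + α * P A := by gcongr; exact mul_le_of_le_one_right' prob_le_one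

theorem one_sub_le_hockeyStick (α : ℝ≥0) (P Q : Measure O) [IsProbabilityMeasure P]
    [IsProbabilityMeasure Q] : 1 - (α : ℝ≥0∞) ≤ hockeyStick α P Q := by
  simpa using measure_le_hockeyStick_add α P Q .univ

theorem hockeyStick_le_one (α : ℝ≥0) (P Q : Measure O) [IsProbabilityMeasure P]
    [IsFiniteMeasure Q] : hockeyStick α P Q ≤ 1 :=
  hockeyStick_le_iff.2 fun _ _ => prob_le_one.trans le_self_add

theorem hockeyStick_map_le_of_measurePreserving_prod {Ω Ω' R : Type*} [MeasurableSpace Ω]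
    [MeasurableSpace Ω'] [MeasurableSpace R] {μ : Measure Ω} {ρ : Measure R} {μ' : Measure Ω'}
    [IsProbabilityMeasure μ] [IsProbabilityMeasure ρ] {r : Ω × R → Ω'}
    (hr : MeasurePreserving r (μ.prod ρ) μ') {f f' : Ω' → O} (hf : Measurable f)
    (hf' : Measurable f') {c : ℝ≥0∞}
    (h : ∀ ω, hockeyStick α (ρ.map fun a => f (r (ω, a))) (ρ.map fun a => f' (r (ω, a))) ≤ c) :
    hockeyStick α (μ'.map f) (μ'.map f') ≤ c := by
  have hmap {g : Ω' → O} (hg : Measurable g) {A : Set O} (hA : MeasurableSet A) :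
      μ'.map g A = ∫⁻ ω, ρ.map (fun a => g (r (ω, a))) A ∂μ := by
    rw [← hr.map_eq, Measure.map_map hg hr.measurable,
      Measure.map_apply (hg.comp hr.measurable) hA,
      Measure.prod_apply (hg.comp hr.measurable hA)]
    refine lintegral_congr fun ω => ?_
    exact (Measure.map_apply (hg.comp (hr.measurable.comp measurable_prodMk_left)) hA).symm
  have := Measure.isProbabilityMeasure_map (μ := μ.prod ρ) hr.measurable.aemeasurable
  rw [hr.map_eq] at this
  refine hockeyStick_le_iff.2 fun A hA => ?_
  rw [hmap hf hA, hmap hf' hA]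
  calc ∫⁻ ω, ρ.map (fun a => f (r (ω, a))) A ∂μ
      ≤ ∫⁻ ω, (c + α * ρ.map (fun a => f' (r (ω, a))) A) ∂μ :=
        lintegral_mono fun ω => hockeyStick_le_iff.1 (h ω) A hA
    _ = c + α * ∫⁻ ω, ρ.map (fun a => f' (r (ω, a))) A ∂μ := by
        rw [lintegral_add_left measurable_const, lintegral_const_mul' _ _ ENNReal.coe_ne_top]
        simp

end HockeyStick

theorem hockeyStick_le_privacyProfile {ι X O : Type*} [MeasurableSpace O]
    {M : ι → X → Measure O} {R : X → X → Prop} {α : ℝ≥0} (i : ι) {x x' : X} (hx : R x x') :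
    hockeyStick α (M i x) (M i x') ≤ privacyProfile M R α :=
  le_iSup_of_le i (le_iSup_of_le x (le_iSup_of_le x' (le_iSup_of_le hx le_rfl)))

theorem measurePreserving_update {ι : Type*} [Fintype ι] [DecidableEq ι] {X : ι → Type*}
    [∀ i, MeasurableSpace (X i)] (μ : ∀ i, Measure (X i)) [∀ i, IsProbabilityMeasure (μ i)]
    (i : ι) :
    MeasurePreserving (fun p : (∀ i, X i) × X i => Function.update p.1 i p.2)
      ((Measure.pi μ).prod (μ i)) (Measure.pi μ) := by
  refine ⟨measurable_update', (Measure.pi_eq fun s hs => ?_).symm⟩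
  have hpre : (fun p : (∀ i, X i) × X i => Function.update p.1 i p.2) ⁻¹' Set.univ.pi s =
      Set.univ.pi (Function.update s i Set.univ) ×ˢ s i := by
    ext ⟨ω, a⟩
    simp only [Set.mem_preimage, Set.mem_univ_pi, Set.mem_prod]
    rw [Function.forall_update_iff ω (fun j y => y ∈ s j),
      Function.forall_update_iff s (fun j A => ω j ∈ A)]
    simp [and_comm]
  rw [Measure.map_apply measurable_update' (.univ_pi hs), hpre, Measure.prod_prod, Measure.pi_pi,
    Fintype.prod_eq_mul_prod_compl i, Fintype.prod_eq_mul_prod_compl i, Function.update_self,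
    measure_univ, one_mul, mul_comm]
  congr 1
  refine Finset.prod_congr rfl fun j hj => ?_
  rw [Function.update_of_ne (by simpa using hj)]

/-! ### The Neyman–Pearson lemma on the line -/

section GaussianReal

open Filter Asymptotics

variable {v : ℝ≥0}

theorem gaussianReal_real_eq_setIntegral (m : ℝ) (hv : v ≠ 0) (A : Set ℝ) :
    (gaussianReal m v).real A = ∫ t in A, gaussianPDFReal m v t := by
  rw [measureReal_def, gaussianReal_apply_eq_integral _ hv,
    ENNReal.toReal_ofReal (integral_nonneg fun t => gaussianPDFReal_nonneg _ _ _)]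

theorem gaussianPDFReal_eq_mul_exp (x y : ℝ) (v : ℝ≥0) (t : ℝ) :
    gaussianPDFReal x v t =
      gaussianPDFReal y v t * Real.exp ((x - y) * (2 * t - x - y) / (2 * v)) := by
  have h : -(t - x) ^ 2 / (2 * v) =
      -(t - y) ^ 2 / (2 * v) + (x - y) * (2 * t - x - y) / (2 * v) := by ring
  rw [gaussianPDFReal, gaussianPDFReal, h, Real.exp_add, ← mul_assoc]

theorem gaussianPDFReal_neg_arg (x t : ℝ) (v : ℝ≥0) :
    gaussianPDFReal x v (-t) = gaussianPDFReal (-x) v t := by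
  simp only [gaussianPDFReal]
  congr 3
  ring

theorem continuous_gaussianPDFReal (x : ℝ) (v : ℝ≥0) : Continuous (gaussianPDFReal x v) := by
  unfold gaussianPDFReal
  fun_prop

theorem setIntegral_le_setIntegral_of_sign {X : Type*} [MeasurableSpace X] {μ : Measure X}
    {f : X → ℝ} (hf : Integrable f μ) {A S : Set X} (hA : MeasurableSet A) (hS : MeasurableSet S)
    (hpos : ∀ t ∈ S, 0 ≤ f t) (hneg : ∀ t ∉ S, f t ≤ 0) :
    ∫ t in A, f t ∂μ ≤ ∫ t in S, f t ∂μ := by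
  rw [← integral_indicator hA, ← integral_indicator hS]
  refine integral_mono (hf.indicator hA) (hf.indicator hS) fun t => ?_
  by_cases htA : t ∈ A <;> by_cases htS : t ∈ S <;> simp [htA, htS, hpos, hneg]

theorem neymanPearson_gaussianReal {a b x y τ : ℝ} (hv : v ≠ 0) (ha : 0 ≤ a) (hxy : y ≤ x)
    (hτ : a * gaussianPDFReal x v τ = b * gaussianPDFReal y v τ) {A : Set ℝ}
    (hA : MeasurableSet A) :
    a * (gaussianReal x v).real A - b * (gaussianReal y v).real A ≤
      a * (gaussianReal x v).real (Set.Ici τ) - b * (gaussianReal y v).real (Set.Ici τ) := by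
  have hx := (integrable_gaussianPDFReal x v).const_mul a
  have hy := (integrable_gaussianPDFReal y v).const_mul b
  have hintegral (B : Set ℝ) : a * (gaussianReal x v).real B - b * (gaussianReal y v).real B =
      ∫ t in B, (a * gaussianPDFReal x v t - b * gaussianPDFReal y v t) := by
    rw [integral_sub hx.integrableOn hy.integrableOn, integral_const_mul, integral_const_mul,
      gaussianReal_real_eq_setIntegral _ hv, gaussianReal_real_eq_setIntegral _ hv]
  set ratio : ℝ → ℝ := fun t => Real.exp ((x - y) * (2 * t - x - y) / (2 * v))
  have hmono : Monotone ratio := fun t t' h => by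
    have : 0 ≤ x - y := sub_nonneg.2 hxy
    dsimp only [ratio]
    gcongr
  have hb : b = a * ratio τ := by
    rw [gaussianPDFReal_eq_mul_exp x y] at hτ
    exact mul_right_cancel₀ (gaussianPDFReal_pos y v τ hv).ne' (by linarith)
  have hdiff (t : ℝ) : a * gaussianPDFReal x v t - b * gaussianPDFReal y v t =
      a * gaussianPDFReal y v t * (ratio t - ratio τ) := by
    rw [gaussianPDFReal_eq_mul_exp x y, hb]
    ring
  have hweight (t : ℝ) : 0 ≤ a * gaussianPDFReal y v t :=
    mul_nonneg ha (gaussianPDFReal_nonneg _ _ _)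
  rw [hintegral, hintegral]
  refine setIntegral_le_setIntegral_of_sign (hx.sub hy) hA measurableSet_Ici
    (fun t ht => ?_) fun t ht => ?_ <;> rw [Pi.sub_apply, hdiff]
  · exact mul_nonneg (hweight t) (sub_nonneg.2 (hmono ht))
  · exact mul_nonpos_of_nonneg_of_nonpos (hweight t)
      (sub_nonpos.2 (hmono (not_le.1 ht).le))

theorem isLittleO_gaussianPDFReal {x y : ℝ} (hxy : y < x) (hv : v ≠ 0) :
    gaussianPDFReal y v =o[atTop] gaussianPDFReal x v := by
  have hexp : Tendsto (fun t : ℝ => Real.exp ((y - x) * (2 * t - y - x) / (2 * v))) atTop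
      (nhds 0) := by
    refine Real.tendsto_exp_atBot.comp (Tendsto.atBot_div_const (by positivity)
      (Tendsto.const_mul_atTop_of_neg (sub_neg.2 hxy) ?_))
    simp_rw [sub_sub]
    exact tendsto_atTop_add_const_right _ _ (tendsto_id.const_mul_atTop two_pos)
  have hprod := (isBigO_refl (gaussianPDFReal x v) atTop).mul_isLittleO
    ((isLittleO_one_iff ℝ).2 hexp)
  simp only [mul_one] at hprod
  exact hprod.congr_left fun t => (gaussianPDFReal_eq_mul_exp y x v t).symm

variable {ι κ : Type*} [Fintype ι] [Fintype κ] {a : ι → ℝ} {b : κ → ℝ} {x : ι → ℝ} {y : κ → ℝ}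

theorem exists_sum_gaussianPDFReal_le (hv : v ≠ 0) (ha : ∀ i, 0 ≤ a i) {i₀ : ι} (hi₀ : 0 < a i₀)
    (hlt : ∀ j, y j < x i₀) :
    ∃ τ, ∑ j, b j * gaussianPDFReal (y j) v τ ≤ ∑ i, a i * gaussianPDFReal (x i) v τ := by
  have hlittle : (fun τ => ∑ j, b j * gaussianPDFReal (y j) v τ) =o[atTop]
      gaussianPDFReal (x i₀) v :=
    IsLittleO.fun_sum fun j _ => (isLittleO_gaussianPDFReal (hlt j) hv).const_mul_left (b j)
  obtain ⟨τ, hτ⟩ := (hlittle.bound hi₀).exists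
  rw [Real.norm_eq_abs, Real.norm_of_nonneg (gaussianPDFReal_nonneg _ _ _)] at hτ
  exact ⟨τ, (le_abs_self _).trans (hτ.trans (Finset.single_le_sum
    (f := fun i => a i * gaussianPDFReal (x i) v τ)
    (fun i _ => mul_nonneg (ha i) (gaussianPDFReal_nonneg _ _ _)) (Finset.mem_univ i₀)))⟩

theorem exists_sum_gaussianPDFReal_eq (hv : v ≠ 0) (ha : ∀ i, 0 ≤ a i) (hb : ∀ j, 0 ≤ b j)
    {i₀ : ι} (hi₀ : 0 < a i₀) (hlt : ∀ j, y j < x i₀)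
    {j₀ : κ} (hj₀ : 0 < b j₀) (hlt' : ∀ i, y j₀ < x i) :
    ∃ τ, ∑ i, a i * gaussianPDFReal (x i) v τ = ∑ j, b j * gaussianPDFReal (y j) v τ := by
  obtain ⟨τ₁, h₁⟩ := exists_sum_gaussianPDFReal_le (b := b) hv ha hi₀ hlt
  obtain ⟨τ₂, h₂⟩ := exists_sum_gaussianPDFReal_le (b := a) (y := fun i => -x i)
    (x := fun j => -y j) hv hb hj₀ (fun i => neg_lt_neg (hlt' i))
  have hcont (m : ℝ) := continuous_gaussianPDFReal m v
  refine intermediate_value_univ₂ (by fun_prop) (by fun_prop) (a := -τ₂) (b := τ₁) ?_ h₁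
  simpa only [gaussianPDFReal_neg_arg] using h₂

end GaussianReal

/-! ### Isotropic Gaussians -/

section IsoGaussian

open scoped RealInnerProductSpace

theorem exists_norm_adjoint_sq {E : Type*} [NormedAddCommGroup E] [InnerProductSpace ℝ E]
    [CompleteSpace E] {h : E} (hh : ‖h‖ ≤ 1) :
    ∃ M : E →L[ℝ] E, ∀ t, ‖M.adjoint t‖ ^ 2 = ‖t‖ ^ 2 - ⟪h, t⟫ ^ 2 := by
  set r := √(1 - ‖h‖ ^ 2)
  have hr : r ^ 2 = 1 - ‖h‖ ^ 2 := Real.sq_sqrt (by nlinarith [norm_nonneg h])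
  have hr1 : 1 + r ≠ 0 := by positivity
  -- `(I - c h hᵀ)² = I - (2 c - c² ‖h‖²) h hᵀ`, and this `c` makes the bracket equal to `1`.
  set c := 1 / (1 + r) with hc
  have hcoef : 2 * c - c ^ 2 * ‖h‖ ^ 2 = 1 := by
    rw [hc]
    field_simp
    linear_combination -hr
  refine ⟨ContinuousLinearMap.adjoint
    (ContinuousLinearMap.id ℝ E - c • (innerSL ℝ h).smulRight h), fun t => ?_⟩
  have happly : (ContinuousLinearMap.id ℝ E - c • (innerSL ℝ h).smulRight h) t =
      t - (c * ⟪h, t⟫) • h := by simp [mul_smul]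
  rw [ContinuousLinearMap.adjoint_adjoint, happly, norm_sub_sq_real, norm_smul,
    real_inner_smul_right, mul_pow, Real.norm_eq_abs, sq_abs, real_inner_comm h t]
  linear_combination (-⟪h, t⟫ ^ 2) * hcoef

variable {E : Type*} [NormedAddCommGroup E] [InnerProductSpace ℝ E] [FiniteDimensional ℝ E]
  [MeasurableSpace E] [BorelSpace E]

theorem stdGaussian_real : stdGaussian ℝ = gaussianReal 0 1 := by
  refine Measure.ext_of_charFun (funext fun t => ?_)
  rw [charFun_stdGaussian, charFun_gaussianReal, ← Complex.ofReal_pow, Real.norm_eq_abs, sq_abs]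
  simp [neg_div]

theorem charFun_map_stdGaussian {F : Type*} [NormedAddCommGroup F] [InnerProductSpace ℝ F]
    [FiniteDimensional ℝ F] [MeasurableSpace F] [BorelSpace F] (L : E →L[ℝ] F) (t : F) :
    charFun ((stdGaussian E).map L) t = Complex.exp (-‖L.adjoint t‖ ^ 2 / 2) := by
  rw [← charFun_stdGaussian, charFun_apply, charFun_apply,
    integral_map (by fun_prop) (by fun_prop)]
  simp_rw [ContinuousLinearMap.adjoint_inner_right]

theorem map_inner_stdGaussian {e : E} (he : ‖e‖ = 1) :
    (stdGaussian E).map (fun z => ⟪e, z⟫) = stdGaussian ℝ := by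
  refine Measure.ext_of_charFun (funext fun t => ?_)
  rw [charFun_stdGaussian]
  refine (charFun_map_stdGaussian (innerSL ℝ e) t).trans ?_
  simp [ContinuousLinearMap.adjoint_innerSL_apply, norm_smul, he]

theorem map_smul_add_stdGaussian {h : E} {M : E →L[ℝ] E}
    (hM : ∀ t, ‖M.adjoint t‖ ^ 2 = ‖t‖ ^ 2 - ⟪h, t⟫ ^ 2) :
    ((stdGaussian ℝ).prod (stdGaussian E)).map (fun p => p.1 • h + M p.2) = stdGaussian E := by
  have hsplit : (fun p : ℝ × E => p.1 • h + M p.2) =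
      (fun p : E × E => p.1 + p.2) ∘ Prod.map (fun ξ : ℝ => ξ • h) M := rfl
  have hspan : Measurable fun ξ : ℝ => ξ • h := by fun_prop
  have := Measure.isProbabilityMeasure_map (μ := stdGaussian ℝ) hspan.aemeasurable
  have := Measure.isProbabilityMeasure_map (μ := stdGaussian E) M.measurable.aemeasurable
  rw [hsplit, ← Measure.map_map (by fun_prop) (by fun_prop),
    ← Measure.map_prod_map _ _ hspan M.measurable]
  refine Measure.ext_of_charFun ?_
  rw [charFun_map_add_prod_eq_mul]
  ext t
  have hcharFun : charFun ((stdGaussian ℝ).map fun ξ : ℝ => ξ • h) t =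
      Complex.exp (-⟪h, t⟫ ^ 2 / 2) := by
    refine (charFun_map_stdGaussian (.toSpanSingleton ℝ h) t).trans ?_
    rw [ContinuousLinearMap.adjoint_toSpanSingleton, innerSL_apply_apply, Real.norm_eq_abs,
      ← Complex.ofReal_pow, sq_abs, Complex.ofReal_pow]
  rw [Pi.mul_apply, hcharFun, charFun_map_stdGaussian, charFun_stdGaussian, ← Complex.exp_add,
    ← Complex.ofReal_pow ‖M.adjoint t‖, hM]
  congr 1
  push_cast
  ring

/-- The isotropic Gaussian distribution with mean `u` and standard deviation `|s|`. -/
def isoGaussian (s : ℝ) (u : E) : Measure E := (stdGaussian E).map fun z => u + s • z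

instance (s : ℝ) (u : E) : IsProbabilityMeasure (isoGaussian s u) :=
  Measure.isProbabilityMeasure_map (by fun_prop)

theorem isoGaussian_real (s m : ℝ) : isoGaussian s m = gaussianReal m (‖s‖₊ ^ 2) := by
  have hcomp : (fun ξ : ℝ => m + s • ξ) = (m + ·) ∘ (s * ·) := rfl
  rw [isoGaussian, stdGaussian_real, hcomp, ← Measure.map_map (by fun_prop) (by fun_prop),
    gaussianReal_map_const_mul, gaussianReal_map_const_add]
  congr 1
  · simp
  · ext; simp

theorem exists_isoGaussian_add_smul_eq_map {h : E} (hh : ‖h‖ ≤ 1) (s : ℝ) (w : E) :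
    ∃ f : ℝ × E → E, Measurable f ∧
      ∀ r : ℝ, isoGaussian s (w + r • h) = ((isoGaussian s r).prod (stdGaussian E)).map f := by
  obtain ⟨M, hM⟩ := exists_norm_adjoint_sq hh
  refine ⟨fun p => w + (p.1 • h + s • M p.2), by fun_prop, fun r => ?_⟩
  have hprod := Measure.map_prod_map (stdGaussian ℝ) (stdGaussian E)
    (f := fun ξ : ℝ => r + s • ξ) (g := id) (by fun_prop) measurable_id
  rw [Measure.map_id] at hprod
  rw [isoGaussian, isoGaussian, hprod, Measure.map_map (by fun_prop) (by fun_prop)]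
  conv_lhs => rw [← map_smul_add_stdGaussian hM]
  rw [Measure.map_map (by fun_prop) (by fun_prop)]
  congr 1
  ext p
  simp only [Function.comp, Prod.map, id]
  module

theorem linearTest_map_prod_le {X Y Z : Type*} [MeasurableSpace X] [MeasurableSpace Y]
    [MeasurableSpace Z] {μ ν : Measure X} [IsProbabilityMeasure μ] [IsProbabilityMeasure ν]
    {ρ : Measure Z} [IsProbabilityMeasure ρ] {f : X × Z → Y} (hf : Measurable f) {a b c : ℝ}
    (h : ∀ B, MeasurableSet B → a * μ.real B - b * ν.real B ≤ c) {A : Set Y}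
    (hA : MeasurableSet A) :
    a * ((μ.prod ρ).map f).real A - b * ((ν.prod ρ).map f).real A ≤ c := by
  have hslice (z : Z) : MeasurableSet {x | f (x, z) ∈ A} := (hf.comp measurable_prodMk_right) hA
  have hint (μ : Measure X) [IsProbabilityMeasure μ] :
      Integrable (fun z => μ.real {x | f (x, z) ∈ A}) ρ :=
    Integrable.of_bound (C := 1)
      (measurable_measure_prodMk_right (hf hA)).ennreal_toReal.aestronglyMeasurable
      (.of_forall fun z => by simp [abs_of_nonneg])
  have hfubini (μ : Measure X) [IsProbabilityMeasure μ] :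
      ((μ.prod ρ).map f).real A = ∫ z, μ.real {x | f (x, z) ∈ A} ∂ρ := by
    rw [measureReal_def, Measure.map_apply hf hA, Measure.prod_apply_symm (hf hA)]
    exact (integral_toReal (measurable_measure_prodMk_right (hf hA)).aemeasurable
      (.of_forall fun z => measure_lt_top _ _)).symm
  rw [hfubini, hfubini, ← integral_const_mul, ← integral_const_mul,
    ← integral_sub ((hint μ).const_mul _) ((hint ν).const_mul _)]
  refine (integral_mono (((hint μ).const_mul _).sub ((hint ν).const_mul _))
    (integrable_const c) fun z => h _ (hslice z)).trans_eq (by simp)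

variable {s τ : ℝ}

theorem neymanPearson_isoGaussian {a b x y : ℝ} (hs : s ≠ 0) (ha : 0 ≤ a)
    (hτ : a * gaussianPDFReal x (‖s‖₊ ^ 2) τ = b * gaussianPDFReal y (‖s‖₊ ^ 2) τ)
    {u w : E} (hd : ‖u - w‖ ≤ x - y) {A : Set E} (hA : MeasurableSet A) :
    a * (isoGaussian s u).real A - b * (isoGaussian s w).real A ≤
      a * (isoGaussian s x).real (Set.Ici τ) - b * (isoGaussian s y).real (Set.Ici τ) := by
  have hxy : 0 ≤ x - y := (norm_nonneg _).trans hd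
  obtain ⟨h, hh, hu⟩ : ∃ h : E, ‖h‖ ≤ 1 ∧ u - w = (x - y) • h := by
    refine ⟨(x - y)⁻¹ • (u - w), ?_, ?_⟩
    · rw [norm_smul, norm_inv, Real.norm_of_nonneg hxy]
      exact inv_mul_le_one_of_le₀ hd hxy
    · rcases hxy.eq_or_lt with h0 | h0
      · rw [← h0] at hd ⊢
        simpa using norm_le_zero_iff.1 hd
      · rw [smul_inv_smul₀ h0.ne']
  obtain ⟨f, hf, hmap⟩ := exists_isoGaussian_add_smul_eq_map hh s (w - y • h)
  have hu' : u = w - y • h + x • h := by rw [← sub_add_cancel u w, hu]; module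
  rw [hu', hmap x, ← sub_add_cancel w (y • h), hmap y]
  refine linearTest_map_prod_le hf (fun B hB => ?_) hA
  simp only [isoGaussian_real]
  exact neymanPearson_gaussianReal (by simpa using hs) ha (sub_nonneg.1 hxy) hτ hB

theorem neymanPearson_mixture {ι κ : Type*} [Fintype ι] [Fintype κ] {a : ι → ℝ} {b : κ → ℝ}
    {x : ι → ℝ} {y : κ → ℝ} (hs : s ≠ 0) (ha : ∀ i, 0 ≤ a i) (hb : ∀ j, 0 ≤ b j)
    (hτ : ∑ i, a i * gaussianPDFReal (x i) (‖s‖₊ ^ 2) τ =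
      ∑ j, b j * gaussianPDFReal (y j) (‖s‖₊ ^ 2) τ)
    {u : ι → E} {w : κ → E} (hd : ∀ i j, ‖u i - w j‖ ≤ x i - y j) {A : Set E}
    (hA : MeasurableSet A) :
    ∑ i, a i * (isoGaussian s (u i)).real A - ∑ j, b j * (isoGaussian s (w j)).real A ≤
      ∑ i, a i * (isoGaussian s (x i)).real (Set.Ici τ)
        - ∑ j, b j * (isoGaussian s (y j)).real (Set.Ici τ) := by
  set p : ι → ℝ := fun i => gaussianPDFReal (x i) (‖s‖₊ ^ 2) τ
  set q : κ → ℝ := fun j => gaussianPDFReal (y j) (‖s‖₊ ^ 2) τ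
  have hv : ‖s‖₊ ^ 2 ≠ 0 := by simpa using hs
  have hp (i : ι) : 0 < p i := gaussianPDFReal_pos _ _ _ hv
  have hq (j : κ) : 0 < q j := gaussianPDFReal_pos _ _ _ hv
  -- Scaled by the common density at `τ`, the difference of mixtures is a sum over pairs whose
  -- weighted densities agree at `τ`.
  have hpairs (f : ι → ℝ) (g : κ → ℝ) : (∑ i, a i * p i) * (∑ i, a i * f i - ∑ j, b j * g j) =
      ∑ i, ∑ j, (a i * (b j * q j) * f i - b j * (a i * p i) * g j) := by
    simp_rw [Finset.sum_sub_distrib]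
    rw [mul_sub]
    congr 1
    · rw [hτ, Finset.sum_mul_sum, Finset.sum_comm]
      exact Finset.sum_congr rfl fun i _ => Finset.sum_congr rfl fun j _ => by ring
    · rw [Finset.sum_mul_sum]
      exact Finset.sum_congr rfl fun i _ => Finset.sum_congr rfl fun j _ => by ring
  rcases (Finset.sum_nonneg fun i _ => mul_nonneg (ha i) (hp i).le :
    0 ≤ ∑ i, a i * p i).eq_or_lt with h0 | h0
  · have ha0 (i : ι) : a i = 0 := (mul_eq_zero.1 ((Finset.sum_eq_zero_iff_of_nonneg
      fun i _ => mul_nonneg (ha i) (hp i).le).1 h0.symm i (Finset.mem_univ _))).resolve_right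
      (hp i).ne'
    have hb0 (j : κ) : b j = 0 := (mul_eq_zero.1 ((Finset.sum_eq_zero_iff_of_nonneg
      fun j _ => mul_nonneg (hb j) (hq j).le).1 (h0.trans hτ).symm j
      (Finset.mem_univ _))).resolve_right (hq j).ne'
    simp [ha0, hb0]
  · refine le_of_mul_le_mul_left ?_ h0
    rw [hpairs, hpairs]
    refine Finset.sum_le_sum fun i _ => Finset.sum_le_sum fun j _ => ?_
    refine neymanPearson_isoGaussian hs (mul_nonneg (ha i) (mul_nonneg (hb j) (hq j).le)) ?_
      (hd i j) hA
    simp only [p, q]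
    ring

end IsoGaussian

/-! ### Bottom-level sampling -/

section SubsetProb

variable {ι : Type*} [DecidableEq ι] {q q' : ℝ} {F : Finset ι → ℝ}

theorem sum_powerset_insert_bernoulli {a : ι} {s : Finset ι} (ha : a ∉ s) (q : ℝ)
    (F : Finset ι → ℝ) :
    ∑ S ∈ (insert a s).powerset, (∏ t ∈ insert a s, if t ∈ S then q else 1 - q) * F S =
      ∑ S ∈ s.powerset, (∏ t ∈ s, if t ∈ S then q else 1 - q) *
        ((1 - q) * F S + q * F (insert a S)) := by
  rw [Finset.sum_powerset_insert ha, ← Finset.sum_add_distrib]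
  refine Finset.sum_congr rfl fun S hS => ?_
  have haS : a ∉ S := fun h => ha (Finset.mem_powerset.1 hS h)
  have hprod : ∏ t ∈ s, (if t ∈ insert a S then q else 1 - q) =
      ∏ t ∈ s, if t ∈ S then q else 1 - q :=
    Finset.prod_congr rfl fun t ht => by simp [ne_of_mem_of_not_mem ht ha]
  rw [Finset.prod_insert ha, Finset.prod_insert ha, if_neg haS,
    if_pos (Finset.mem_insert_self _ _), hprod]
  ring

theorem sum_powerset_bernoulli_mono (s : Finset ι) (hq : 0 ≤ q) (hqq' : q ≤ q') (hq' : q' ≤ 1)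
    (hF : Monotone F) :
    ∑ S ∈ s.powerset, (∏ t ∈ s, if t ∈ S then q else 1 - q) * F S ≤
      ∑ S ∈ s.powerset, (∏ t ∈ s, if t ∈ S then q' else 1 - q') * F S := by
  induction s using Finset.induction_on generalizing F with
  | empty => simp
  | insert a s ha ih =>
    rw [sum_powerset_insert_bernoulli ha, sum_powerset_insert_bernoulli ha]
    have hmono : Monotone fun S => (1 - q) * F S + q * F (insert a S) := by
      intro S S' h
      have hdel := hF h
      have hins := hF (Finset.insert_subset_insert a h)
      have hq1 : 0 ≤ 1 - q := by linarith
      dsimp only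
      gcongr
    refine (ih hmono).trans (Finset.sum_le_sum fun S _ => mul_le_mul_of_nonneg_left ?_ ?_)
    · have := hF (Finset.subset_insert a S)
      nlinarith
    · exact Finset.prod_nonneg fun t _ => by split_ifs <;> linarith

variable [Fintype ι]

/-- The probability of the subset `S` under Poisson sampling at rate `q`. -/
def subsetProb (q : ℝ) (S : Finset ι) : ℝ := ∏ t, if t ∈ S then q else 1 - q

theorem subsetProb_nonneg (hq : 0 ≤ q) (hq' : q ≤ 1) (S : Finset ι) : 0 ≤ subsetProb q S :=
  Finset.prod_nonneg fun _ _ => by split_ifs <;> linarith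

theorem sum_subsetProb (q : ℝ) : ∑ S : Finset ι, subsetProb q S = 1 := by
  have := Fintype.prod_add (fun _ : ι => q) fun _ => 1 - q
  simp only [add_sub_cancel, Finset.prod_const_one] at this
  rw [this]
  refine Finset.sum_congr rfl fun S _ => ?_
  rw [subsetProb, ← Finset.prod_mul_prod_compl S]
  congr 1
  · exact Finset.prod_congr rfl fun t ht => if_pos ht
  · exact Finset.prod_congr rfl fun t ht => if_neg (Finset.mem_compl.1 ht)

theorem sum_subsetProb_mono (hq : 0 ≤ q) (hqq' : q ≤ q') (hq' : q' ≤ 1) (hF : Monotone F) :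
    ∑ S, subsetProb q S * F S ≤ ∑ S, subsetProb q' S * F S := by
  simpa [subsetProb] using sum_powerset_bernoulli_mono Finset.univ hq hqq' hq' hF

theorem sum_subsetProb_anti (hq : 0 ≤ q) (hqq' : q ≤ q') (hq' : q' ≤ 1) (hF : Antitone F) :
    ∑ S, subsetProb q' S * F S ≤ ∑ S, subsetProb q S * F S := by
  simpa using sum_subsetProb_mono hq hqq' hq' hF.neg

theorem sum_subsetProb_resample (q : ℝ) (A : Finset ι) (F : Finset ι → ℝ) :
    ∑ S, subsetProb q S * F S =
      ∑ V, subsetProb q V * ∑ S, subsetProb q S * F (V \ A ∪ S ∩ A) := by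
  -- Exchanging the parts outside of `A` preserves the law of a pair of independent samples.
  have hswap : Function.Involutive fun p : Finset ι × Finset ι =>
      (p.1 \ A ∪ p.2 ∩ A, p.2 \ A ∪ p.1 ∩ A) := by
    rintro ⟨S, V⟩
    ext t <;> simp <;> tauto
  have hlaw (p : Finset ι × Finset ι) :
      subsetProb q (p.1 \ A ∪ p.2 ∩ A) * subsetProb q (p.2 \ A ∪ p.1 ∩ A) =
        subsetProb q p.1 * subsetProb q p.2 := by
    simp only [subsetProb, ← Finset.prod_mul_distrib]
    refine Finset.prod_congr rfl fun t _ => ?_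
    by_cases h1 : t ∈ p.1 <;> by_cases h2 : t ∈ p.2 <;> by_cases h3 : t ∈ A <;>
      simp [h1, h2, h3, mul_comm]
  calc ∑ S, subsetProb q S * F S
      = ∑ p : Finset ι × Finset ι, subsetProb q p.1 * subsetProb q p.2 * F p.1 := by
        simp_rw [Fintype.sum_prod_type, mul_right_comm _ (subsetProb q _) (F _), ← Finset.mul_sum,
          sum_subsetProb, mul_one]
    _ = ∑ p : Finset ι × Finset ι, subsetProb q p.1 * subsetProb q p.2 *
          F (p.1 \ A ∪ p.2 ∩ A) := by
        rw [← Equiv.sum_comp hswap.toPerm]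
        exact Finset.sum_congr rfl fun p _ => congrArg (· * _) (hlaw p)
    _ = ∑ V, subsetProb q V * ∑ S, subsetProb q S * F (V \ A ∪ S ∩ A) := by
        simp_rw [Fintype.sum_prod_type, mul_assoc, ← Finset.mul_sum]

end SubsetProb

theorem sum_uniform_head {T : ℕ} [NeZero T] (n : ℕ) (f : Fin T → ℝ) :
    ∑ ω : Fin (n + 1) → Fin T, ((T : ℝ) ^ (n + 1))⁻¹ * f (ω 0) = ∑ t, (T : ℝ)⁻¹ * f t := by
  have hT : (T : ℝ) ≠ 0 := by exact_mod_cast NeZero.ne T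
  rw [← (Fin.consEquiv fun _ : Fin (n + 1) => Fin T).sum_comp, Fintype.sum_prod_type]
  refine Finset.sum_congr rfl fun t _ => ?_
  simp only [Fin.consEquiv, Equiv.coe_fn_mk, Fin.cons_zero, Finset.sum_const, Finset.card_univ,
    Fintype.card_pi_const, Fintype.card_fin, nsmul_eq_mul, Nat.cast_pow]
  field_simp
  ring

theorem isoGaussian_real_Ici_le {s m m' τ τ' : ℝ} (h : m - τ ≤ m' - τ') :
    (isoGaussian s m).real (Set.Ici τ) ≤ (isoGaussian s m').real (Set.Ici τ') := by
  rw [isoGaussian, isoGaussian, map_measureReal_apply (by fun_prop) measurableSet_Ici,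
    map_measureReal_apply (by fun_prop) measurableSet_Ici]
  refine measureReal_mono fun ξ hξ => ?_
  simp only [Set.mem_preimage, Set.mem_Ici] at hξ ⊢
  linarith

section ContributionLaw

variable {E : Type*} [NormedAddCommGroup E] [InnerProductSpace ℝ E] [FiniteDimensional ℝ E]
  [MeasurableSpace E] [BorelSpace E] {T : ℕ}

/-- The distribution of the noisy sum of the gradients `g t` over the elements `t` of a random
multiset with distribution `p`, where the noise has standard deviation `|s|`. -/
def contributionLaw (p : PMF (Multiset (Fin T))) (s : ℝ) (g : Fin T → E) : Measure E :=
  (p.toMeasure.prod (stdGaussian E)).map fun ω => (ω.1.map g).sum + s • ω.2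

theorem measurable_sum_map_add_smul (s : ℝ) (g : Fin T → E) :
    Measurable fun ω : Multiset (Fin T) × E => (ω.1.map g).sum + s • ω.2 :=
  (Measurable.of_discrete (f := fun ms : Multiset (Fin T) => (ms.map g).sum)).comp measurable_fst
    |>.add (measurable_snd.const_smul s)

instance (p : PMF (Multiset (Fin T))) (s : ℝ) (g : Fin T → E) :
    IsProbabilityMeasure (contributionLaw p s g) :=
  Measure.isProbabilityMeasure_map (measurable_sum_map_add_smul s g).aemeasurable

theorem contributionLaw_apply (p : PMF (Multiset (Fin T))) (s : ℝ) (g : Fin T → E) {B : Set E}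
    (hB : MeasurableSet B) :
    contributionLaw p s g B = ∫⁻ ms, isoGaussian s (ms.map g).sum B ∂p.toMeasure := by
  have hmeas := measurable_sum_map_add_smul s g
  rw [contributionLaw, Measure.map_apply hmeas hB, Measure.prod_apply (hmeas hB)]
  exact lintegral_congr fun ms => (Measure.map_apply (by fun_prop) hB).symm

theorem contributionLaw_map_real {β : Type*} [Fintype β] (p : PMF β) (φ : β → Multiset (Fin T))
    (s : ℝ) (g : Fin T → E) {B : Set E} (hB : MeasurableSet B) :
    (contributionLaw (p.map φ) s g).real B =
      ∑ i, (p i).toReal * (isoGaussian s ((φ i).map g).sum).real B := by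
  let _ : MeasurableSpace β := ⊤
  have : DiscreteMeasurableSpace β := ⟨fun _ => trivial⟩
  have hφ : Measurable φ := Measurable.of_discrete
  rw [measureReal_def, contributionLaw_apply _ _ _ hB, ← PMF.toMeasure_map φ p hφ,
    lintegral_map Measurable.of_discrete hφ, lintegral_fintype,
    ENNReal.toReal_sum fun i _ => by finiteness]
  refine Finset.sum_congr rfl fun i _ => ?_
  rw [ENNReal.toReal_mul, PMF.toMeasure_apply_singleton p i (measurableSet_singleton i), mul_comm,
    measureReal_def]

variable [NeZero T] {s τ : ℝ} {lam : ℕ}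

theorem contributionLaw_poisson_real (lam : ℕ) (s : ℝ) (g : Fin T → E) {B : Set E}
    (hB : MeasurableSet B) :
    (contributionLaw (BottomLevel.poisson.sample T lam) s g).real B =
      ∑ S, subsetProb (min 1 ((lam : ℝ) / T)) S * (isoGaussian s (∑ t ∈ S, g t)).real B := by
  rw [BottomLevel.sample, contributionLaw_map_real _ _ _ _ hB]
  refine Finset.sum_congr rfl fun S _ => congrArg (· * _) ?_
  rw [poissonSubset, PMF.ofFintype_apply, ENNReal.toReal_prod, subsetProb]
  refine Finset.prod_congr rfl fun t _ => ?_
  rw [apply_ite ENNReal.toReal, ENNReal.toReal_sub_of_le (by exact_mod_cast min_le_left _ _)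
    ENNReal.one_ne_top, ENNReal.coe_toReal, ENNReal.toReal_one]
  push_cast
  rfl

theorem contributionLaw_withReplacement_real (lam : ℕ) (s : ℝ) (g : Fin T → E) {B : Set E}
    (hB : MeasurableSet B) :
    (contributionLaw (BottomLevel.withReplacement.sample T lam) s g).real B =
      ∑ ω : Fin lam → Fin T, ((T : ℝ) ^ lam)⁻¹ * (isoGaussian s (∑ i, g (ω i))).real B := by
  rw [BottomLevel.sample, contributionLaw_map_real _ _ _ _ hB]
  refine Finset.sum_congr rfl fun ω _ => ?_
  rw [Multiset.map_map, PMF.uniformOfFintype_apply]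
  simp [Finset.sum]

theorem contributionLaw_withReplacement_one_real (s : ℝ) (g : Fin T → E) {B : Set E}
    (hB : MeasurableSet B) :
    (contributionLaw (BottomLevel.withReplacement.sample T 1) s g).real B =
      ∑ t, (T : ℝ)⁻¹ * (isoGaussian s (g t)).real B := by
  rw [contributionLaw_withReplacement_real _ _ _ hB,
    ← sum_uniform_head 0 fun t => (isoGaussian s (g t)).real B]
  simp

/-! ### The extremal contributions of a changed sequence -/

/-- The gradients `g t` and `g' t` at the start indices `t` of two sequences are bounded by the
clipping norm `C`, and agree unless the subsequence at `t` contains the changed time step, that is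
unless `t ∈ A`. -/
structure NeighboringGrads {ι : Type*} (C : ℝ) (A : Finset ι) (g g' : ι → E) : Prop where
  norm_le : ∀ t, ‖g t‖ ≤ C
  norm_le' : ∀ t, ‖g' t‖ ≤ C
  eq_of_notMem : ∀ t ∉ A, g t = g' t

/-- The gradients along a fixed direction that are extremal for privacy: `c` at the start indices in
`A`, and `k` at the other ones. -/
def extremalGrad {ι : Type*} [DecidableEq ι] (A : Finset ι) (k c : ℝ) (t : ι) : ℝ :=
  if t ∈ A then c else k

theorem le_extremalGrad {ι : Type*} [DecidableEq ι] (A : Finset ι) {k c : ℝ} (h : k ≤ c) (t : ι) :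
    k ≤ extremalGrad A k c t := by
  unfold extremalGrad; split_ifs <;> simp [h]

theorem extremalGrad_le {ι : Type*} [DecidableEq ι] (A : Finset ι) {k c : ℝ} (h : c ≤ k) (t : ι) :
    extremalGrad A k c t ≤ k := by
  unfold extremalGrad; split_ifs <;> simp [h]

theorem sum_extremalGrad_zero {ι : Type*} [DecidableEq ι] (S A : Finset ι) (c : ℝ) :
    ∑ t ∈ S, extremalGrad A 0 c t = ∑ _t ∈ S ∩ A, c := by
  simp only [extremalGrad, Finset.sum_ite_mem]

theorem contributionLaw_poisson_Ici_mono {lam' : ℕ} {g : Fin T → ℝ} (hg : ∀ t, 0 ≤ g t)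
    (h : lam ≤ lam') :
    (contributionLaw (BottomLevel.poisson.sample T lam) s g).real (Set.Ici τ) ≤
      (contributionLaw (BottomLevel.poisson.sample T lam') s g).real (Set.Ici τ) := by
  rw [contributionLaw_poisson_real _ _ _ measurableSet_Ici,
    contributionLaw_poisson_real _ _ _ measurableSet_Ici]
  refine sum_subsetProb_mono (by positivity) (by gcongr) (min_le_left _ _) fun S S' hS => ?_
  exact isoGaussian_real_Ici_le
    (sub_le_sub_right (Finset.sum_le_sum_of_subset_of_nonneg hS fun t _ _ => hg t) _)

theorem contributionLaw_poisson_Ici_anti {lam' : ℕ} {g : Fin T → ℝ} (hg : ∀ t, g t ≤ 0)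
    (h : lam ≤ lam') :
    (contributionLaw (BottomLevel.poisson.sample T lam') s g).real (Set.Ici τ) ≤
      (contributionLaw (BottomLevel.poisson.sample T lam) s g).real (Set.Ici τ) := by
  rw [contributionLaw_poisson_real _ _ _ measurableSet_Ici,
    contributionLaw_poisson_real _ _ _ measurableSet_Ici]
  refine sum_subsetProb_anti (by positivity) (by gcongr) (min_le_left _ _) fun S S' hS => ?_
  exact isoGaussian_real_Ici_le
    (sub_le_sub_right (Finset.sum_le_sum_of_subset_of_nonpos' hS fun t _ _ => hg t) _)

theorem contributionLaw_withReplacement_Ici_le {k : ℝ} {g : Fin T → ℝ} (hg : ∀ t, k ≤ g t)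
    (n : ℕ) :
    (contributionLaw (BottomLevel.withReplacement.sample T 1) s g).real (Set.Ici τ) ≤
      (contributionLaw (BottomLevel.withReplacement.sample T (n + 1)) s g).real
        (Set.Ici (τ + n * k)) := by
  rw [contributionLaw_withReplacement_one_real _ _ measurableSet_Ici,
    contributionLaw_withReplacement_real _ _ _ measurableSet_Ici, ← sum_uniform_head n]
  refine Finset.sum_le_sum fun ω _ => mul_le_mul_of_nonneg_left ?_ (by positivity)
  have htail : n • k ≤ ∑ i : Fin n, g (ω i.succ) := by
    simpa using Finset.card_nsmul_le_sum Finset.univ _ k fun i _ => hg (ω (Fin.succ i))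
  refine isoGaussian_real_Ici_le ?_
  rw [Fin.sum_univ_succ]
  linarith [nsmul_eq_mul n k]

theorem contributionLaw_withReplacement_Ici_ge {k : ℝ} {g : Fin T → ℝ} (hg : ∀ t, g t ≤ k)
    (n : ℕ) :
    (contributionLaw (BottomLevel.withReplacement.sample T (n + 1)) s g).real
        (Set.Ici (τ + n * k)) ≤
      (contributionLaw (BottomLevel.withReplacement.sample T 1) s g).real (Set.Ici τ) := by
  rw [contributionLaw_withReplacement_one_real _ _ measurableSet_Ici,
    contributionLaw_withReplacement_real _ _ _ measurableSet_Ici, ← sum_uniform_head n]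
  refine Finset.sum_le_sum fun ω _ => mul_le_mul_of_nonneg_left ?_ (by positivity)
  have htail : ∑ i : Fin n, g (ω i.succ) ≤ n • k := by
    simpa using Finset.sum_le_card_nsmul Finset.univ _ k fun i _ => hg (ω (Fin.succ i))
  refine isoGaussian_real_Ici_le ?_
  rw [Fin.sum_univ_succ]
  linarith [nsmul_eq_mul n k]

variable {A : Finset (Fin T)} {α C : ℝ}

theorem neymanPearson_poisson {ι : Type*} [Fintype ι] [DecidableEq ι] {A : Finset ι} {q : ℝ}
    (hs : s ≠ 0) (hα : 0 ≤ α) (hq : 0 ≤ q) (hq' : q ≤ 1)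
    (hτ : ∑ S, subsetProb q S *
        gaussianPDFReal (∑ t ∈ S, extremalGrad A 0 C t) (‖s‖₊ ^ 2) τ =
      ∑ S, α * subsetProb q S *
        gaussianPDFReal (∑ t ∈ S, extremalGrad A 0 (-C) t) (‖s‖₊ ^ 2) τ)
    {g g' : ι → E} (hg : NeighboringGrads C A g g') {B : Set E} (hB : MeasurableSet B) :
    ∑ S, subsetProb q S * (isoGaussian s (∑ t ∈ S, g t)).real B
        - ∑ S, α * subsetProb q S * (isoGaussian s (∑ t ∈ S, g' t)).real B ≤
      ∑ S, subsetProb q S * (isoGaussian s (∑ t ∈ S, extremalGrad A 0 C t)).real (Set.Ici τ)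
        - ∑ S, α * subsetProb q S *
            (isoGaussian s (∑ t ∈ S, extremalGrad A 0 (-C) t)).real (Set.Ici τ) := by
  have hprob := subsetProb_nonneg (ι := ι) hq hq'
  set R := ∑ S, subsetProb q S *
      (isoGaussian s (∑ t ∈ S, extremalGrad A 0 C t)).real (Set.Ici τ)
    - ∑ S, α * subsetProb q S *
      (isoGaussian s (∑ t ∈ S, extremalGrad A 0 (-C) t)).real (Set.Ici τ)
  -- Given the sampled elements `V \ A`, the two sums of gradients differ by at most `C` per element
  -- of the independent samples inside of `A`.
  have hcond (V : Finset ι) : ∑ S, subsetProb q S *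
      (isoGaussian s (∑ t ∈ V \ A ∪ S ∩ A, g t)).real B
        - ∑ S, α * subsetProb q S * (isoGaussian s (∑ t ∈ V \ A ∪ S ∩ A, g' t)).real B ≤ R := by
    have hdisj (S : Finset ι) : Disjoint (V \ A) (S ∩ A) :=
      Finset.sdiff_disjoint.mono_right Finset.inter_subset_right
    have hV : ∑ t ∈ V \ A, g' t = ∑ t ∈ V \ A, g t :=
      Finset.sum_congr rfl fun t ht => (hg.eq_of_notMem t (Finset.mem_sdiff.1 ht).2).symm
    simp_rw [Finset.sum_union (hdisj _), hV]
    refine neymanPearson_mixture hs hprob (fun S => mul_nonneg hα (hprob S)) hτ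
      (fun S S' => ?_) hB
    rw [add_sub_add_left_eq_sub, sum_extremalGrad_zero, sum_extremalGrad_zero,
      Finset.sum_neg_distrib, sub_neg_eq_add]
    exact (norm_sub_le _ _).trans (add_le_add (norm_sum_le_of_le _ fun t _ => hg.norm_le t)
      (norm_sum_le_of_le _ fun t _ => hg.norm_le' t))
  calc _ = ∑ V, subsetProb q V * (∑ S, subsetProb q S *
          (isoGaussian s (∑ t ∈ V \ A ∪ S ∩ A, g t)).real B
        - ∑ S, α * subsetProb q S * (isoGaussian s (∑ t ∈ V \ A ∪ S ∩ A, g' t)).real B) := by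
        simp_rw [mul_sub, Finset.sum_sub_distrib, mul_assoc α, ← Finset.mul_sum,
          mul_left_comm _ α, ← Finset.mul_sum]
        rw [← sum_subsetProb_resample q A fun S => (isoGaussian s (∑ t ∈ S, g t)).real B,
          ← sum_subsetProb_resample q A fun S => (isoGaussian s (∑ t ∈ S, g' t)).real B]
    _ ≤ ∑ V, subsetProb q V * R :=
        Finset.sum_le_sum fun V _ => mul_le_mul_of_nonneg_left (hcond V) (hprob V)
    _ = R := by rw [← Finset.sum_mul, sum_subsetProb, one_mul]

theorem exists_threshold_poisson (hA : A.Nonempty) (hα : 0 < α) (hC : 0 < C) (hs : s ≠ 0)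
    (hlam : 0 < lam) :
    ∃ τ, ∀ g g' : Fin T → E, NeighboringGrads C A g g' → ∀ B, MeasurableSet B →
      (contributionLaw (BottomLevel.poisson.sample T lam) s g).real B
          - α * (contributionLaw (BottomLevel.poisson.sample T lam) s g').real B ≤
        (contributionLaw (BottomLevel.poisson.sample T lam) s (extremalGrad A 0 C)).real
            (Set.Ici τ)
          - α * (contributionLaw (BottomLevel.poisson.sample T lam) s
              (extremalGrad A 0 (-C))).real (Set.Ici τ) := by
  have hT : 0 < T := Nat.pos_of_ne_zero (NeZero.ne T)
  set q : ℝ := min 1 ((lam : ℝ) / T) with hq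
  have hq0 : 0 < q := by positivity
  have hprob := subsetProb_nonneg (ι := Fin T) hq0.le (min_le_left _ _)
  have huniv : 0 < subsetProb q (Finset.univ : Finset (Fin T)) :=
    Finset.prod_pos fun t _ => by simpa using hq0
  have hsum (c : ℝ) (S : Finset (Fin T)) :
      ∑ t ∈ S, extremalGrad A 0 c t = (S ∩ A).card * c := by simp [sum_extremalGrad_zero]
  have hAC : 0 < A.card * C := mul_pos (by exact_mod_cast hA.card_pos) hC
  have hSC (S : Finset (Fin T)) : 0 ≤ (S ∩ A).card * C := by positivity
  obtain ⟨τ, hτ⟩ := exists_sum_gaussianPDFReal_eq (v := ‖s‖₊ ^ 2) (a := subsetProb q)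
    (b := fun S => α * subsetProb q S) (x := fun S => ∑ t ∈ S, extremalGrad A 0 C t)
    (y := fun S => ∑ t ∈ S, extremalGrad A 0 (-C) t) (by simpa using hs) hprob
    (fun S => mul_nonneg hα.le (hprob S)) huniv
    (fun S => by rw [hsum, hsum, Finset.univ_inter]; linarith [hSC S]) (mul_pos hα huniv)
    (fun S => by rw [hsum, hsum, Finset.univ_inter]; linarith [hSC S])
  refine ⟨τ, fun g g' hg B hB => ?_⟩
  simp only [contributionLaw_poisson_real _ _ _ hB,
    contributionLaw_poisson_real _ _ _ measurableSet_Ici, ← hq, Finset.mul_sum, ← mul_assoc]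
  exact neymanPearson_poisson hs hα.le hq0.le (min_le_left _ _) hτ hg hB

theorem exists_threshold_withReplacement (hA : A.Nonempty) (hα : 0 < α) (hC : 0 < C)
    (hs : s ≠ 0) :
    ∃ k τ, |k| ≤ C ∧ ∀ g g' : Fin T → E, NeighboringGrads C A g g' → ∀ B, MeasurableSet B →
      (contributionLaw (BottomLevel.withReplacement.sample T 1) s g).real B
          - α * (contributionLaw (BottomLevel.withReplacement.sample T 1) s g').real B ≤
        (contributionLaw (BottomLevel.withReplacement.sample T 1) s (extremalGrad A k C)).real
            (Set.Ici τ)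
          - α * (contributionLaw (BottomLevel.withReplacement.sample T 1) s
              (extremalGrad A k (-C))).real (Set.Ici τ) := by
  obtain ⟨t₀, ht₀⟩ := hA
  -- At the start indices outside of `A` both mixtures have the same component, so that only the
  -- difference `1 - α` of its weights matters, and one of the two weights can be made zero.
  set a : Fin T → ℝ := fun t => if t ∈ A then 1 else max (1 - α) 0 with ha
  set b : Fin T → ℝ := fun t => if t ∈ A then α else max (α - 1) 0 with hb
  have hab : max (1 - α) 0 - max (α - 1) 0 = 1 - α := by
    rw [← neg_sub 1 α, max_zero_sub_max_neg_zero_eq_self]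
  have ha0 (t : Fin T) : 0 ≤ a t := by simp only [ha]; split_ifs <;> simp
  have hb0 (t : Fin T) : 0 ≤ b t := by simp only [hb]; split_ifs <;> simp [hα.le]
  have hat : 0 < a t₀ := by simp [ha, ht₀]
  have hbt : 0 < b t₀ := by simp [hb, ht₀, hα]
  obtain ⟨τ, hτ⟩ := exists_sum_gaussianPDFReal_eq (v := ‖s‖₊ ^ 2) (x := fun _ => C)
    (y := fun _ => -C) (by simpa using hs) ha0 hb0 hat (fun _ => by linarith) hbt
    (fun _ => by linarith)
  refine ⟨if 1 ≤ α then -C else C, τ, by split_ifs <;> simp [abs_of_pos hC],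
    fun g g' hg B hB => ?_⟩
  simp only [contributionLaw_withReplacement_one_real _ _ hB,
    contributionLaw_withReplacement_one_real _ _ measurableSet_Ici, ← Finset.mul_sum,
    mul_left_comm α, ← mul_sub]
  refine mul_le_mul_of_nonneg_left ?_ (by positivity)
  have hmixture := neymanPearson_mixture hs ha0 hb0 hτ (u := g) (w := g') (fun t t' => by
    rw [sub_neg_eq_add]
    exact (norm_sub_le _ _).trans (add_le_add (hg.norm_le t) (hg.norm_le' t'))) hB
  simp only [Finset.mul_sum, ← Finset.sum_sub_distrib] at hmixture ⊢
  refine (Finset.sum_congr rfl fun t _ => ?_).trans_le (hmixture.trans_eq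
    (Finset.sum_congr rfl fun t _ => ?_))
  · by_cases ht : t ∈ A
    · simp only [ha, hb, if_pos ht, one_mul]
    · simp only [ha, hb, if_neg ht, hg.eq_of_notMem t ht, ← sub_mul, hab]
      ring
  · by_cases ht : t ∈ A
    · simp only [ha, hb, if_pos ht, extremalGrad, one_mul]
    · simp only [ha, hb, if_neg ht, extremalGrad]
      split_ifs with h
      · rw [max_eq_right (by linarith), max_eq_left (by linarith)]; ring
      · rw [max_eq_left (by linarith), max_eq_right (by linarith)]; ring

theorem exists_hockeyStick_contributionLaw_le (S : BottomLevel) {α : ℝ≥0} (hA : A.Nonempty)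
    (hα : 0 < α) (hC : 0 < C) (hs : s ≠ 0) (hlam : 1 ≤ lam) :
    ∃ k, |k| ≤ C ∧ ∀ g g' : Fin T → E, NeighboringGrads C A g g' →
      hockeyStick α (contributionLaw (S.sample T 1) s g) (contributionLaw (S.sample T 1) s g') ≤
        hockeyStick α (contributionLaw (S.sample T lam) s (extremalGrad A k C))
          (contributionLaw (S.sample T lam) s (extremalGrad A k (-C))) := by
  have hα' : (0 : ℝ) < α := hα
  cases S with
  | poisson =>
    obtain ⟨τ, hτ⟩ := exists_threshold_poisson (E := E) hA hα' hC hs one_pos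
    refine ⟨0, by simpa using hC.le, fun g g' hg => hockeyStick_le_hockeyStick fun B hB =>
      ⟨Set.Ici τ, measurableSet_Ici, (hτ g g' hg B hB).trans ?_⟩⟩
    gcongr
    · exact contributionLaw_poisson_Ici_mono (le_extremalGrad A hC.le) hlam
    · exact contributionLaw_poisson_Ici_anti (extremalGrad_le A (neg_nonpos.2 hC.le)) hlam
  | withReplacement =>
    obtain ⟨k, τ, hk, hτ⟩ := exists_threshold_withReplacement (E := E) hA hα' hC hs
    obtain ⟨n, rfl⟩ := Nat.exists_eq_add_of_le' hlam
    refine ⟨k, hk, fun g g' hg => hockeyStick_le_hockeyStick fun B hB =>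
      ⟨Set.Ici (τ + n * k), measurableSet_Ici, (hτ g g' hg B hB).trans ?_⟩⟩
    gcongr
    · exact contributionLaw_withReplacement_Ici_le (le_extremalGrad A (abs_le.1 hk).2) n
    · exact contributionLaw_withReplacement_Ici_ge (extremalGrad_le A (abs_le.1 hk).1) n

end ContributionLaw

/-! ### Gradient descent with one changed step -/

section GradientDescent

variable {E : Type*} [AddCommGroup E] [Module ℝ E] {K : ℕ}

/-- The parameters after `k` steps of gradient descent with initial parameters `θ₀` and learning
rate `η`, where step `b` at the parameters `θ` uses the gradient estimate `G b θ`. After the last of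
the `K` steps, the parameters stay constant. -/
def gradientDescent (η : ℝ) (θ₀ : E) (G : Fin K → E → E) : ℕ → E
  | 0 => θ₀
  | k + 1 =>
    if h : k < K then gradientDescent η θ₀ G k - η • G ⟨k, h⟩ (gradientDescent η θ₀ G k)
    else gradientDescent η θ₀ G k

/-- The gradient estimates used in the successive steps of gradient descent. -/
def gradientTrace (η : ℝ) (θ₀ : E) (G : Fin K → E → E) (b : Fin K) : E :=
  G b (gradientDescent η θ₀ G b)

variable (η : ℝ) (θ₀ : E)

theorem gradientDescent_update_of_le (G : Fin K → E → E) {b : Fin K} (φ : E → E) {k : ℕ}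
    (hk : k ≤ b) :
    gradientDescent η θ₀ (Function.update G b φ) k = gradientDescent η θ₀ G k := by
  induction k with
  | zero => rfl
  | succ k ih =>
    have hne (h : k < K) : (⟨k, h⟩ : Fin K) ≠ b := fun h' => by
      have := congrArg Fin.val h'
      simp only at this
      omega
    simp only [gradientDescent, ih (by omega), Function.update_of_ne (hne _)]

theorem gradientDescent_update_const (G : Fin K → E → E) (b : Fin K) (k : ℕ) :
    gradientDescent η θ₀ (Function.update G b fun _ => gradientTrace η θ₀ G b) k =
      gradientDescent η θ₀ G k := by
  induction k with
  | zero => rfl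
  | succ k ih =>
    simp only [gradientDescent, ih]
    split_ifs with h
    · by_cases hb : (⟨k, h⟩ : Fin K) = b
      · subst hb
        rw [Function.update_self, gradientTrace]
      · rw [Function.update_of_ne hb]
    · rfl

theorem gradientTrace_update (G : Fin K → E → E) (b : Fin K) (φ : E → E) :
    gradientTrace η θ₀ (Function.update G b φ) =
      gradientTrace η θ₀ (Function.update G b fun _ => φ (gradientDescent η θ₀ G b)) := by
  have hb : gradientTrace η θ₀ (Function.update G b φ) b = φ (gradientDescent η θ₀ G b) := by
    rw [gradientTrace, Function.update_self, gradientDescent_update_of_le _ _ _ _ le_rfl]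
  have hdescent := gradientDescent_update_const η θ₀ (Function.update G b φ) b
  rw [hb, Function.update_idem] at hdescent
  ext1 k
  rw [gradientTrace, gradientTrace, hdescent]
  by_cases hk : k = b
  · subst hk
    rw [Function.update_self, Function.update_self, gradientDescent_update_of_le _ _ _ _ le_rfl]
  · rw [Function.update_of_ne hk, Function.update_of_ne hk]

variable {R : Type*}

theorem gradientTrace_random_update {G : Fin K → E → R → E} {H : Fin K → E → E} {b : Fin K}
    {ω : Fin K → R} (hH : ∀ k, k ≠ b → ∀ θ, G k θ (ω k) = H k θ) (a : R) :
    gradientTrace η θ₀ (fun k θ => G k θ (Function.update ω b a k)) =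
      gradientTrace η θ₀ (Function.update H b fun _ => G b (gradientDescent η θ₀ H b) a) := by
  rw [← gradientTrace_update η θ₀ H b fun θ => G b θ a]
  congr 1
  ext1 k
  by_cases hk : k = b
  · subst hk
    simp only [Function.update_self]
  · simp only [Function.update_of_ne hk, hH k hk]

variable [MeasurableSpace E] [MeasurableSub₂ E] [MeasurableConstSMul ℝ E]

theorem measurable_gradientDescent {X : Type*} [MeasurableSpace X] {G : X → Fin K → E → E}
    (hG : ∀ b, Measurable fun p : X × E => G p.1 b p.2) (k : ℕ) :
    Measurable fun a => gradientDescent η θ₀ (G a) k := by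
  induction k with
  | zero => exact measurable_const
  | succ k ih =>
    simp only [gradientDescent]
    split_ifs with h
    · exact ih.sub (((hG ⟨k, h⟩).comp (measurable_id.prodMk ih)).const_smul η)
    · exact ih

theorem measurable_gradientTrace {X : Type*} [MeasurableSpace X] {G : X → Fin K → E → E}
    (hG : ∀ b, Measurable fun p : X × E => G p.1 b p.2) :
    Measurable fun a => gradientTrace η θ₀ (G a) :=
  measurable_pi_lambda _ fun b =>
    (hG b).comp (measurable_id.prodMk (measurable_gradientDescent η θ₀ hG b))

variable [MeasurableSpace R]

theorem measurable_gradientTrace_random {G : Fin K → E → R → E}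
    (hG : ∀ b, Measurable fun p : E × R => G b p.1 p.2) :
    Measurable fun ω : Fin K → R => gradientTrace η θ₀ fun b θ => G b θ (ω b) :=
  measurable_gradientTrace η θ₀ fun b =>
    (hG b).comp (measurable_snd.prodMk ((measurable_pi_apply b).comp measurable_fst))

theorem hockeyStick_gradientTrace_le {ρ : Measure R} [IsProbabilityMeasure ρ]
    {G G' : Fin K → E → R → E} (hG : ∀ b, Measurable fun p : E × R => G b p.1 p.2)
    (hG' : ∀ b, Measurable fun p : E × R => G' b p.1 p.2) {b : Fin K}
    (hne : ∀ k, k ≠ b → G k = G' k) {α : ℝ≥0} {c : ℝ≥0∞}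
    (hb : ∀ θ, hockeyStick α (ρ.map (G b θ)) (ρ.map (G' b θ)) ≤ c) :
    hockeyStick α
      ((Measure.pi fun _ => ρ).map fun ω => gradientTrace η θ₀ fun k θ => G k θ (ω k))
      ((Measure.pi fun _ => ρ).map fun ω => gradientTrace η θ₀ fun k θ => G' k θ (ω k)) ≤ c := by
  refine hockeyStick_map_le_of_measurePreserving_prod (measurePreserving_update (fun _ => ρ) b)
    (measurable_gradientTrace_random η θ₀ hG) (measurable_gradientTrace_random η θ₀ hG')
    fun ω => ?_
  -- Given the randomness of all other steps, the trace is a fixed function `F` of the gradient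
  -- estimate in step `b`, which is evaluated at fixed parameters `θ`.
  set H : Fin K → E → E := fun k θ => G k θ (ω k)
  set θ := gradientDescent η θ₀ H b with hθ
  set F : E → Fin K → E := fun g => gradientTrace η θ₀ (Function.update H b fun _ => g) with hFdef
  have hF : Measurable F := by
    refine measurable_gradientTrace η θ₀ fun k => ?_
    by_cases hk : k = b
    · subst hk
      simpa only [Function.update_self] using measurable_fst
    · simp only [Function.update_of_ne hk]
      exact (hG k).comp (measurable_snd.prodMk measurable_const)
  have hmeas : Measurable (G b θ) := (hG b).comp measurable_prodMk_left
  have hmeas' : Measurable (G' b θ) := (hG' b).comp measurable_prodMk_left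
  have hmap : (ρ.map fun a => gradientTrace η θ₀ fun k θ => G k θ (Function.update ω b a k)) =
      (ρ.map (G b θ)).map F := by
    rw [Measure.map_map hF hmeas]
    congr 1
    ext1 a
    exact gradientTrace_random_update η θ₀ (fun _ _ _ => rfl) a
  have hmap' : (ρ.map fun a => gradientTrace η θ₀ fun k θ => G' k θ (Function.update ω b a k)) =
      (ρ.map (G' b θ)).map F := by
    rw [Measure.map_map hF hmeas']
    congr 1
    ext1 a
    exact gradientTrace_random_update η θ₀ (fun k hk θ => by rw [← hne k hk]) a
  rw [hmap, hmap']
  have := Measure.isProbabilityMeasure_map (μ := ρ) hmeas.aemeasurable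
  have := Measure.isProbabilityMeasure_map (μ := ρ) hmeas'.aemeasurable
  exact (hockeyStick_map_le hF).trans (hb θ)

end GradientDescent

/-! ### An epoch with one changed sequence -/

theorem ForecastModel.measurable_grad {D LC LF : ℕ} (m : ForecastModel D LC LF)
    (c : Fin LC → ℝ) (y : Fin LF → ℝ) : Measurable fun θ => m.grad θ c y :=
  (InnerProductSpace.toDual ℝ (Params D)).symm.continuous.measurable.comp (measurable_fderiv ℝ _)

theorem measurable_clip {D : ℕ} (C : ℝ) : Measurable (clip C : Params D → Params D) := by
  unfold clip
  fun_prop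

theorem norm_clip_le {D : ℕ} {C : ℝ} (hC : 0 < C) (g : Params D) : ‖clip C g‖ ≤ C := by
  have hpos : 0 < max 1 (‖g‖ / C) := one_pos.trans_le (le_max_left _ _)
  rw [clip, norm_smul, norm_inv, Real.norm_eq_abs, abs_of_pos hpos, inv_mul_le_iff₀ hpos,
    ← div_le_iff₀ hC]
  exact le_max_right _ _

theorem prependZeros_congr {L LC : ℕ} {a a' : Fin L → ℝ} {t₀ : Fin L}
    (h : ∀ s, s ≠ t₀ → a s = a' s) {s : ℕ} (hs : s ≠ LC + t₀) :
    prependZeros LC a s = prependZeros LC a' s := by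
  unfold prependZeros
  split_ifs with hrange
  · exact h _ fun heq => by simp only [Fin.ext_iff] at heq; omega
  · rfl

namespace EpochConfig

variable (cfg : EpochConfig) {lam : ℕ}

/-- The clipped gradient of the subsequence of `a` with start index `t`. -/
def clippedGrad (m : ForecastModel cfg.D cfg.LC cfg.LF) (θ : Params cfg.D) (a : Fin cfg.L → ℝ)
    (t : Fin cfg.T) : Params cfg.D :=
  clip cfg.C (m.grad θ (contextWindow cfg.LC a t) (forecastWindow cfg.LC cfg.LF a t))

theorem noisyGradient_eq (m : ForecastModel cfg.D cfg.LC cfg.LF) (x : Dataset cfg.N cfg.L)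
    (b : Fin (cfg.numSteps lam)) (θ : Params cfg.D) (ω : cfg.StepRandomness lam) :
    cfg.noisyGradient m x b θ ω = (1 / (cfg.batchSize : ℝ)) •
      (∑ j, ((ω.1 j).map (cfg.clippedGrad m θ (x (cfg.topLevel b j)))).sum +
        (cfg.σ * cfg.C) • ω.2) := rfl

theorem measurable_clippedGrad (m : ForecastModel cfg.D cfg.LC cfg.LF) (a : Fin cfg.L → ℝ)
    (t : Fin cfg.T) : Measurable fun θ => cfg.clippedGrad m θ a t :=
  (measurable_clip _).comp (m.measurable_grad _ _)

theorem measurable_sum_map_clippedGrad (m : ForecastModel cfg.D cfg.LC cfg.LF)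
    (a : Fin cfg.L → ℝ) : Measurable fun p : Params cfg.D × Multiset (Fin cfg.T) =>
      (p.2.map (cfg.clippedGrad m p.1 a)).sum := by
  refine measurable_from_prod_countable_left fun ms => ?_
  dsimp only
  induction ms using Multiset.induction_on with
  | empty => simp only [Multiset.map_zero, Multiset.sum_zero, measurable_const]
  | cons t ms ih =>
    simp only [Multiset.map_cons, Multiset.sum_cons]
    exact (cfg.measurable_clippedGrad m a t).add ih

theorem measurable_noisyGradient (m : ForecastModel cfg.D cfg.LC cfg.LF) (x : Dataset cfg.N cfg.L)
    (b : Fin (cfg.numSteps lam)) :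
    Measurable fun p : Params cfg.D × cfg.StepRandomness lam =>
      cfg.noisyGradient m x b p.1 p.2 := by
  have hsum (j : Fin (cfg.seqsPerBatch lam)) :
      Measurable fun p : Params cfg.D × cfg.StepRandomness lam =>
        ((p.2.1 j).map (cfg.clippedGrad m p.1 (x (cfg.topLevel b j)))).sum := by
    have hpair : Measurable fun p : Params cfg.D × cfg.StepRandomness lam => (p.1, p.2.1 j) :=
      measurable_fst.prodMk ((measurable_pi_apply j).comp measurable_snd.fst)
    have hcomp := (cfg.measurable_sum_map_clippedGrad m (x (cfg.topLevel b j))).comp hpair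
    exact hcomp
  have hnoise : Measurable fun p : Params cfg.D × cfg.StepRandomness lam =>
      (cfg.σ * cfg.C) • p.2.2 := measurable_snd.snd.fun_const_smul _
  simp only [noisyGradient_eq]
  exact ((Finset.measurable_fun_sum _ fun j _ => hsum j).add hnoise).fun_const_smul _

instance (S : BottomLevel) : IsProbabilityMeasure (cfg.stepRandomnessLaw lam S) := by
  unfold stepRandomnessLaw
  infer_instance

theorem measurePreserving_stepRandomness_update (S : BottomLevel)
    (j₀ : Fin (cfg.seqsPerBatch lam)) :
    MeasurePreserving (fun p : (Fin (cfg.seqsPerBatch lam) → Multiset (Fin cfg.T)) ×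
        (Multiset (Fin cfg.T) × Params cfg.D) => (Function.update p.1 j₀ p.2.1, p.2.2))
      ((Measure.pi fun _ => (S.sample cfg.T lam).toMeasure).prod
        ((S.sample cfg.T lam).toMeasure.prod (stdGaussian (Params cfg.D))))
      (cfg.stepRandomnessLaw lam S) :=
  ((measurePreserving_update (fun _ => (S.sample cfg.T lam).toMeasure) j₀).prod
    (MeasurePreserving.id _)).comp (measurePreserving_prodAssoc _ _ _).symm

theorem iterate_eq_gradientDescent (m : ForecastModel cfg.D cfg.LC cfg.LF)
    (x : Dataset cfg.N cfg.L) (ω : Fin (cfg.numSteps lam) → cfg.StepRandomness lam) (k : ℕ) :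
    cfg.iterate m x ω k =
      gradientDescent cfg.η cfg.θ₀ (fun b θ => cfg.noisyGradient m x b θ (ω b)) k := by
  induction k with
  | zero => rfl
  | succ k ih => simp only [iterate, gradientDescent, ih]

theorem output_eq_gradientTrace (m : ForecastModel cfg.D cfg.LC cfg.LF)
    (x : Dataset cfg.N cfg.L) :
    cfg.output m x = fun ω : Fin (cfg.numSteps lam) → cfg.StepRandomness lam =>
      gradientTrace cfg.η cfg.θ₀ fun b θ => cfg.noisyGradient m x b θ (ω b) := by
  ext1 ω
  ext1 b
  rw [output, gradientTrace, iterate_eq_gradientDescent]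

theorem measurable_output (m : ForecastModel cfg.D cfg.LC cfg.LF) (x : Dataset cfg.N cfg.L) :
    Measurable (cfg.output m x (lam := lam)) := by
  rw [output_eq_gradientTrace]
  exact measurable_gradientTrace_random _ _ (cfg.measurable_noisyGradient m x)

instance (S : BottomLevel) (m : ForecastModel cfg.D cfg.LC cfg.LF) (x : Dataset cfg.N cfg.L) :
    IsProbabilityMeasure (cfg.epoch lam S m x) :=
  Measure.isProbabilityMeasure_map (cfg.measurable_output m x).aemeasurable

theorem topLevel_inj {b b' : Fin (cfg.numSteps lam)} {j j' : Fin (cfg.seqsPerBatch lam)} :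
    cfg.topLevel b j = cfg.topLevel b' j' ↔ b = b' ∧ j = j' := by
  refine ⟨fun h => ?_, by rintro ⟨rfl, rfl⟩; rfl⟩
  simp only [topLevel, Fin.mk.injEq] at h
  have hdiv (b : Fin (cfg.numSteps lam)) (j : Fin (cfg.seqsPerBatch lam)) :
      ((b : ℕ) * cfg.seqsPerBatch lam + j) / cfg.seqsPerBatch lam = b := by
    rw [add_comm, Nat.add_mul_div_right _ _ j.pos, Nat.div_eq_of_lt j.2, zero_add]
  have hb : b = b' := Fin.ext (by rw [← hdiv b j, ← hdiv b' j', h])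
  subst hb
  exact ⟨rfl, Fin.ext (Nat.add_left_cancel h)⟩

/-- The start indices of the subsequences that contain the time step `t₀`. -/
def startsCovering (t₀ : Fin cfg.L) : Finset (Fin cfg.T) :=
  {t | (t : ℕ) ≤ cfg.LC + t₀ ∧ cfg.LC + t₀ < t + cfg.LC + cfg.LF}

variable {cfg}

theorem mem_startsCovering {t₀ : Fin cfg.L} {t : Fin cfg.T} :
    t ∈ cfg.startsCovering t₀ ↔
      (t : ℕ) ≤ cfg.LC + t₀ ∧ cfg.LC + t₀ < t + cfg.LC + cfg.LF := by
  simp only [startsCovering, Finset.mem_filter, Finset.mem_univ, true_and]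

theorem startsCovering_nonempty (hLF : 0 < cfg.LF) (hL : cfg.LF ≤ cfg.L) (t₀ : Fin cfg.L) :
    (cfg.startsCovering t₀).Nonempty := by
  have := t₀.2
  refine ⟨⟨t₀ + 1 - cfg.LF, by simp only [T, numStarts]; omega⟩, mem_startsCovering.2 ?_⟩
  simp only
  omega

variable {m : ForecastModel cfg.D cfg.LC cfg.LF} {x x' : Dataset cfg.N cfg.L} {n : Fin cfg.N}
  {S : BottomLevel}

theorem clippedGrad_congr {a a' : Fin cfg.L → ℝ} {t₀ : Fin cfg.L}
    (h : ∀ s, s ≠ t₀ → a s = a' s) {t : Fin cfg.T} (ht : t ∉ cfg.startsCovering t₀)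
    (θ : Params cfg.D) : cfg.clippedGrad m θ a t = cfg.clippedGrad m θ a' t := by
  rw [mem_startsCovering] at ht
  have hcontext : contextWindow cfg.LC a t = contextWindow cfg.LC a' t := by
    ext i
    exact prependZeros_congr h (by omega)
  have hforecast : forecastWindow cfg.LC cfg.LF a t = forecastWindow cfg.LC cfg.LF a' t := by
    ext i
    exact prependZeros_congr h (by omega)
  rw [clippedGrad, clippedGrad, hcontext, hforecast]

theorem neighboringGrads_clippedGrad (hC : 0 < cfg.C) {a a' : Fin cfg.L → ℝ} {t₀ : Fin cfg.L}
    (h : ∀ s, s ≠ t₀ → a s = a' s) (θ : Params cfg.D) :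
    NeighboringGrads cfg.C (cfg.startsCovering t₀) (cfg.clippedGrad m θ a)
      (cfg.clippedGrad m θ a') where
  norm_le _ := norm_clip_le hC _
  norm_le' _ := norm_clip_le hC _
  eq_of_notMem _ ht := clippedGrad_congr h ht θ

theorem noisyGradient_congr (hx : ∀ k, k ≠ n → x k = x' k) {b : Fin (cfg.numSteps lam)}
    (hb : ∀ j, cfg.topLevel b j ≠ n) : cfg.noisyGradient m x b = cfg.noisyGradient m x' b := by
  ext1 θ
  ext1 ω
  simp only [noisyGradient_eq, fun j => hx _ (hb j)]

theorem epoch_congr_of_unused (hx : ∀ k, k ≠ n → x k = x' k)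
    (hn : ∀ (b : Fin (cfg.numSteps lam)) (j : Fin (cfg.seqsPerBatch lam)),
      cfg.topLevel b j ≠ n) :
    cfg.epoch lam S m x = cfg.epoch lam S m x' := by
  rw [epoch, epoch, output_eq_gradientTrace, output_eq_gradientTrace]
  simp only [fun b => noisyGradient_congr (m := m) hx (hn b)]

theorem map_noisyGradient_update (m : ForecastModel cfg.D cfg.LC cfg.LF)
    (x : Dataset cfg.N cfg.L) (S : BottomLevel) (b : Fin (cfg.numSteps lam)) (θ : Params cfg.D)
    (ms : Fin (cfg.seqsPerBatch lam) → Multiset (Fin cfg.T)) (j₀ : Fin (cfg.seqsPerBatch lam)) :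
    (((S.sample cfg.T lam).toMeasure.prod (stdGaussian (Params cfg.D))).map fun a =>
      cfg.noisyGradient m x b θ (Function.update ms j₀ a.1, a.2)) =
    (contributionLaw (S.sample cfg.T lam) (cfg.σ * cfg.C)
      (cfg.clippedGrad m θ (x (cfg.topLevel b j₀)))).map fun v => (1 / (cfg.batchSize : ℝ)) •
        (∑ j ∈ {j₀}ᶜ, ((ms j).map (cfg.clippedGrad m θ (x (cfg.topLevel b j)))).sum + v) := by
  rw [contributionLaw, Measure.map_map (by fun_prop) (measurable_sum_map_add_smul _ _)]
  congr 1
  ext1 a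
  have hrest : ∑ j ∈ {j₀}ᶜ, ((Function.update ms j₀ a.1 j).map
      (cfg.clippedGrad m θ (x (cfg.topLevel b j)))).sum =
      ∑ j ∈ {j₀}ᶜ, ((ms j).map (cfg.clippedGrad m θ (x (cfg.topLevel b j)))).sum :=
    Finset.sum_congr rfl fun j hj => by
      rw [Function.update_of_ne (by simpa only [Finset.mem_compl, Finset.mem_singleton] using hj)]
  simp only [noisyGradient_eq, Fintype.sum_eq_add_sum_compl j₀, Function.update_self, hrest,
    Function.comp]
  rw [add_comm (Multiset.sum _), add_assoc]

theorem hockeyStick_noisyGradient_le (hx : ∀ k, k ≠ n → x k = x' k)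
    {b : Fin (cfg.numSteps lam)} {j₀ : Fin (cfg.seqsPerBatch lam)} (hj₀ : cfg.topLevel b j₀ = n)
    {α : ℝ≥0} {c : ℝ≥0∞} (θ : Params cfg.D)
    (hc : hockeyStick α
      (contributionLaw (S.sample cfg.T lam) (cfg.σ * cfg.C) (cfg.clippedGrad m θ (x n)))
      (contributionLaw (S.sample cfg.T lam) (cfg.σ * cfg.C) (cfg.clippedGrad m θ (x' n))) ≤ c) :
    hockeyStick α ((cfg.stepRandomnessLaw lam S).map (cfg.noisyGradient m x b θ))
      ((cfg.stepRandomnessLaw lam S).map (cfg.noisyGradient m x' b θ)) ≤ c := by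
  have hmeas (x : Dataset cfg.N cfg.L) : Measurable (cfg.noisyGradient m x b θ) :=
    (cfg.measurable_noisyGradient m x b).of_uncurry_left
  refine hockeyStick_map_le_of_measurePreserving_prod
    (cfg.measurePreserving_stepRandomness_update S j₀) (hmeas x) (hmeas x') fun ms => ?_
  have hrest : ∑ j ∈ {j₀}ᶜ, ((ms j).map (cfg.clippedGrad m θ (x (cfg.topLevel b j)))).sum =
      ∑ j ∈ {j₀}ᶜ, ((ms j).map (cfg.clippedGrad m θ (x' (cfg.topLevel b j)))).sum :=
    Finset.sum_congr rfl fun j hj => by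
      rw [hx _ fun h => (Finset.mem_compl.1 hj) (Finset.mem_singleton.2
        (cfg.topLevel_inj.1 (h.trans hj₀.symm)).2)]
  rw [map_noisyGradient_update, map_noisyGradient_update, hj₀, hrest]
  exact (hockeyStick_map_le (by fun_prop)).trans hc

theorem hockeyStick_epoch_le (hC : 0 < cfg.C) {t₀ : Fin cfg.L}
    (hxn : ∀ s, s ≠ t₀ → x n s = x' n s) (hx : ∀ k, k ≠ n → x k = x' k)
    {b : Fin (cfg.numSteps lam)} {j₀ : Fin (cfg.seqsPerBatch lam)} (hj₀ : cfg.topLevel b j₀ = n)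
    {α : ℝ≥0} {c : ℝ≥0∞}
    (hc : ∀ g g' : Fin cfg.T → Params cfg.D,
      NeighboringGrads cfg.C (cfg.startsCovering t₀) g g' →
        hockeyStick α (contributionLaw (S.sample cfg.T lam) (cfg.σ * cfg.C) g)
          (contributionLaw (S.sample cfg.T lam) (cfg.σ * cfg.C) g') ≤ c) :
    hockeyStick α (cfg.epoch lam S m x) (cfg.epoch lam S m x') ≤ c := by
  rw [epoch, epoch, output_eq_gradientTrace, output_eq_gradientTrace]
  refine hockeyStick_gradientTrace_le _ _ (cfg.measurable_noisyGradient m x)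
    (cfg.measurable_noisyGradient m x') (b := b) (fun k hk => noisyGradient_congr hx fun j h => ?_)
    fun θ => hockeyStick_noisyGradient_le hx hj₀ θ
      (hc _ _ (neighboringGrads_clippedGrad hC hxn θ))
  exact hk (cfg.topLevel_inj.1 (h.trans hj₀.symm)).1

end EpochConfig

/-! ### The extremal instance -/

section ExtremalInstance

open scoped RealInnerProductSpace

theorem nonempty_embedding_prod_real (n : ℕ) : Nonempty ((Fin n → ℝ) × ℝ ↪ ℝ) := by
  rw [← Cardinal.le_def, Cardinal.mk_prod, Cardinal.lift_id, Cardinal.lift_id]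
  refine Cardinal.mul_le_of_le (Cardinal.aleph0_le_mk ℝ) ?_ le_rfl
  rw [← Cardinal.power_def, Cardinal.mk_fin]
  exact_mod_cast Cardinal.power_nat_le (Cardinal.aleph0_le_mk ℝ)

/-- An injective encoding of a context and a real number by a single real number. It lets a forecast
of any length pass the whole context on to the loss. -/
def encodeReal (n : ℕ) : (Fin n → ℝ) × ℝ ↪ ℝ :=
  (nonempty_embedding_prod_real n).some

theorem hasGradientAt_mul_inner {E : Type*} [NormedAddCommGroup E] [InnerProductSpace ℝ E]
    [CompleteSpace E] (k : ℝ) (e θ : E) : HasGradientAt (fun θ => k * ⟪e, θ⟫) (k • e) θ := by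
  rw [hasGradientAt_iff_hasFDerivAt]
  refine (((innerSL ℝ e).hasFDerivAt (x := θ)).const_mul k).congr_fderiv ?_
  ext1 v
  simp

section WeightModel

variable {D LC LF : ℕ} (hLF : 0 < LF) (e : Params D) (w : (Fin LC → ℝ) → (Fin LF → ℝ) → ℝ)

/-- A model whose loss gradient on the context `c` and the target `y` is `w c y • e`. -/
def weightModel : ForecastModel D LC LF where
  predict θ c := fun _ => encodeReal LC (c, ⟪e, θ⟫)
  loss ŷ y :=
    let p := Function.invFun (encodeReal LC) (ŷ ⟨0, hLF⟩)
    w p.1 y * p.2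
  differentiable c y := by
    simp only [Function.leftInverse_invFun (encodeReal LC).injective _]
    exact fun θ => (hasGradientAt_mul_inner _ e θ).differentiableAt

theorem grad_weightModel (θ : Params D) (c : Fin LC → ℝ) (y : Fin LF → ℝ) :
    (weightModel hLF e w).grad θ c y = w c y • e := by
  simp only [ForecastModel.grad, weightModel,
    Function.leftInverse_invFun (encodeReal LC).injective _]
  exact (hasGradientAt_mul_inner _ e θ).gradient

end WeightModel

theorem clip_of_norm_le {D : ℕ} {C : ℝ} (hC : 0 < C) {g : Params D} (hg : ‖g‖ ≤ C) :
    clip C g = g := by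
  rw [clip, max_eq_left ((div_le_one hC).2 hg), inv_one, one_smul]

theorem intUnit_cast_ne_natCast_add_two (v : ℤˣ) (n : ℕ) : ((v : ℤ) : ℝ) ≠ n + 2 := by
  rcases Int.units_eq_one_or v with rfl | rfl <;> norm_num <;> linarith [n.cast_nonneg (α := ℝ)]

/-- The dataset whose `n`-th sequence is constantly `n + 2`, except for a spike with value `v = ±1`
at the time step `t₀` of the sequence `n₀`. -/
def spikeDataset {N L : ℕ} (n₀ : Fin N) (t₀ : Fin L) (v : ℤˣ) : Dataset N L where
  toFun n t := if n = n₀ ∧ t = t₀ then ((v : ℤ) : ℝ) else n + 2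
  inj' n n' h := by
    have hspike := congrFun h t₀
    simp only [and_true] at hspike
    split_ifs at hspike with hn hn'
    · rw [hn, hn']
    · exact absurd hspike (intUnit_cast_ne_natCast_add_two v n')
    · exact absurd hspike.symm (intUnit_cast_ne_natCast_add_two v n)
    · exact Fin.ext (by exact_mod_cast add_right_cancel hspike)

section SpikeDataset

variable {N L LC LF : ℕ} (n₀ : Fin N) (t₀ : Fin L) (v : ℤˣ)

theorem spikeDataset_apply (n : Fin N) (t : Fin L) :
    spikeDataset n₀ t₀ v n t = if n = n₀ ∧ t = t₀ then ((v : ℤ) : ℝ) else n + 2 := rfl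

theorem eventNeighboring_spikeDataset :
    EventNeighboring (spikeDataset n₀ t₀ 1 : Dataset N L) (spikeDataset n₀ t₀ (-1)) := by
  refine ⟨n₀, t₀, ?_, fun s hs => ?_, fun m hm => ?_⟩
  · simp only [spikeDataset_apply, and_self, if_true]
    norm_num
  · simp only [spikeDataset_apply, hs, and_false, if_false]
  · ext t
    simp only [spikeDataset_apply, hm, false_and, if_false]

theorem prependZeros_spikeDataset_eq_iff {r : ℤˣ} {n : Fin N} {s : ℕ} :
    prependZeros LC (spikeDataset n₀ t₀ v n) s = ((r : ℤ) : ℝ) ↔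
      v = r ∧ n = n₀ ∧ s = LC + t₀ := by
  have hr : (0 : ℝ) ≠ ((r : ℤ) : ℝ) := by exact_mod_cast r.ne_zero.symm
  have ht₀ := t₀.2
  rw [prependZeros]
  split_ifs with hs
  · have hst : (⟨s - LC, hs.2⟩ : Fin L) = t₀ ↔ s = LC + t₀ := by
      simp only [Fin.ext_iff]
      omega
    simp only [spikeDataset_apply, hst]
    split_ifs with hspike
    · simp [hspike, Units.ext_iff]
    · simp [hspike, (intUnit_cast_ne_natCast_add_two r n).symm]
  · have hst : s ≠ LC + t₀ := by omega
    simp [hst, hr]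

end SpikeDataset

theorem mem_windows_iff {L LC LF : ℕ} {a : Fin L → ℝ} {t : ℕ} {r : ℝ} :
    r ∈ Set.range (contextWindow LC a t) ∪ Set.range (forecastWindow LC LF a t) ↔
      ∃ s, t ≤ s ∧ s < t + LC + LF ∧ prependZeros LC a s = r := by
  constructor
  · rintro (⟨i, rfl⟩ | ⟨j, rfl⟩)
    · exact ⟨t + i, by omega, by omega, rfl⟩
    · exact ⟨t + LC + j, by omega, by omega, rfl⟩
  · rintro ⟨s, hts, hs, rfl⟩
    by_cases hcontext : s < t + LC
    · refine Or.inl ⟨⟨s - t, by omega⟩, ?_⟩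
      rw [contextWindow, Nat.add_sub_cancel' hts]
    · refine Or.inr ⟨⟨s - (t + LC), by omega⟩, ?_⟩
      rw [forecastWindow, Nat.add_sub_cancel' (not_lt.1 hcontext)]

open Classical in
/-- The weight `w` for which `weightModel` attains the extremal contributions on
`spikeDataset n₀ t₀`: the subsequences with a spike `±1` get the weight `±C`, the remaining ones of
the sequence `n₀`, which are recognized by the value `n₀ + 2`, get the weight `k`, and all others
the weight `0`. -/
def spikeWeight {LC LF : ℕ} (hLF : 0 < LF) (n₀ : ℕ) (C k : ℝ) (c : Fin LC → ℝ)
    (y : Fin LF → ℝ) : ℝ :=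
  if 1 ∈ Set.range c ∪ Set.range y then C
  else if -1 ∈ Set.range c ∪ Set.range y then -C
  else if y ⟨0, hLF⟩ = n₀ + 2 then k else 0

theorem abs_spikeWeight_le {LC LF : ℕ} (hLF : 0 < LF) (n₀ : ℕ) {C k : ℝ} (hC : 0 < C)
    (hk : |k| ≤ C) (c : Fin LC → ℝ) (y : Fin LF → ℝ) : |spikeWeight hLF n₀ C k c y| ≤ C := by
  unfold spikeWeight
  split_ifs <;> simp [abs_of_pos hC, hk, hC.le]

namespace EpochConfig

variable {cfg : EpochConfig} {lam : ℕ}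

theorem forecastWindow_zero (hLF : 0 < cfg.LF) (hL : cfg.LF ≤ cfg.L) (a : Fin cfg.L → ℝ)
    (t : Fin cfg.T) :
    forecastWindow cfg.LC cfg.LF a t ⟨0, hLF⟩ =
      a ⟨t, by have := t.2; simp only [T, numStarts] at this; omega⟩ := by
  have ht := t.2
  simp only [T, numStarts] at ht
  simp only [forecastWindow, prependZeros, add_zero, Nat.add_sub_cancel]
  rw [dif_pos (by omega)]

theorem mem_windows_spikeDataset_iff {n₀ n : Fin cfg.N} {t₀ : Fin cfg.L} {v r : ℤˣ}
    {t : Fin cfg.T} :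
    ((r : ℤ) : ℝ) ∈ Set.range (contextWindow cfg.LC (spikeDataset n₀ t₀ v n) t) ∪
        Set.range (forecastWindow cfg.LC cfg.LF (spikeDataset n₀ t₀ v n) t) ↔
      v = r ∧ n = n₀ ∧ t ∈ cfg.startsCovering t₀ := by
  simp only [mem_windows_iff, prependZeros_spikeDataset_eq_iff, mem_startsCovering]
  constructor
  · rintro ⟨s, hts, hs, hv, hn, rfl⟩
    exact ⟨hv, hn, hts, hs⟩
  · rintro ⟨hv, hn, hts, hs⟩
    exact ⟨_, hts, hs, hv, hn, rfl⟩

theorem spikeWeight_spikeDataset (hLF : 0 < cfg.LF) (hL : cfg.LF ≤ cfg.L) (n₀ : Fin cfg.N)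
    (t₀ : Fin cfg.L) (C k : ℝ) (v : ℤˣ) (n : Fin cfg.N) (t : Fin cfg.T) :
    spikeWeight hLF n₀ C k (contextWindow cfg.LC (spikeDataset n₀ t₀ v n) t)
      (forecastWindow cfg.LC cfg.LF (spikeDataset n₀ t₀ v n) t) =
      if n = n₀ then extremalGrad (cfg.startsCovering t₀) k ((v : ℤ) * C) t else 0 := by
  have hpos := mem_windows_spikeDataset_iff (n₀ := n₀) (n := n) (t₀ := t₀) (v := v) (r := 1)
    (t := t)
  have hneg := mem_windows_spikeDataset_iff (n₀ := n₀) (n := n) (t₀ := t₀) (v := v) (r := -1)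
    (t := t)
  simp only [Units.val_one, Int.cast_one, Units.val_neg, Int.cast_neg] at hpos hneg
  simp only [spikeWeight, hpos, hneg, extremalGrad]
  by_cases hcover : n = n₀ ∧ t ∈ cfg.startsCovering t₀
  · rcases Int.units_eq_one_or v with rfl | rfl
    · simp [hcover]
    · simp [hcover]
  · have hspike (h : (t : ℕ) < cfg.L) : ¬(n = n₀ ∧ (⟨t, h⟩ : Fin cfg.L) = t₀) := by
      rintro ⟨hn, rfl⟩
      exact hcover ⟨hn, mem_startsCovering.2 (by simp only; omega)⟩
    rw [if_neg fun h => hcover h.2, if_neg fun h => hcover h.2, forecastWindow_zero hLF hL,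
      spikeDataset_apply, if_neg (hspike _)]
    by_cases hn : n = n₀
    · rw [if_pos (by rw [hn]), if_pos hn, if_neg fun ht => hcover ⟨hn, ht⟩]
    · rw [if_neg hn, if_neg]
      exact fun h => hn (Fin.ext (by exact_mod_cast add_right_cancel h))

theorem clippedGrad_spike (hLF : 0 < cfg.LF) (hL : cfg.LF ≤ cfg.L) (hC : 0 < cfg.C)
    {e : Params cfg.D} (he : ‖e‖ = 1) (n₀ : Fin cfg.N) (t₀ : Fin cfg.L) {k : ℝ}
    (hk : |k| ≤ cfg.C) (v : ℤˣ) (θ : Params cfg.D) (n : Fin cfg.N) (t : Fin cfg.T) :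
    cfg.clippedGrad (weightModel hLF e (spikeWeight hLF n₀ cfg.C k)) θ (spikeDataset n₀ t₀ v n) t =
      (if n = n₀ then extremalGrad (cfg.startsCovering t₀) k ((v : ℤ) * cfg.C) t else 0) • e := by
  rw [clippedGrad, grad_weightModel, clip_of_norm_le hC, spikeWeight_spikeDataset hLF hL]
  rw [norm_smul, he, mul_one]
  exact abs_spikeWeight_le hLF _ hC hk _ _

theorem sum_clippedGrad_spike (hLF : 0 < cfg.LF) (hL : cfg.LF ≤ cfg.L) (hC : 0 < cfg.C)
    {e : Params cfg.D} (he : ‖e‖ = 1) (t₀ : Fin cfg.L) {k : ℝ} (hk : |k| ≤ cfg.C) (v : ℤˣ)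
    {b : Fin (cfg.numSteps lam)} {j₀ : Fin (cfg.seqsPerBatch lam)} {n₀ : Fin cfg.N}
    (hj₀ : cfg.topLevel b j₀ = n₀) (θ : Params cfg.D)
    (ms : Fin (cfg.seqsPerBatch lam) → Multiset (Fin cfg.T)) :
    ∑ j, ((ms j).map (cfg.clippedGrad (weightModel hLF e (spikeWeight hLF n₀ cfg.C k)) θ
      (spikeDataset n₀ t₀ v (cfg.topLevel b j)))).sum =
      ((ms j₀).map (extremalGrad (cfg.startsCovering t₀) k ((v : ℤ) * cfg.C))).sum • e := by
  rw [Fintype.sum_eq_single j₀ fun j hj => ?_]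
  · rw [Multiset.sum_smul, Multiset.map_map]
    congr 1
    refine Multiset.map_congr rfl fun t _ => ?_
    rw [clippedGrad_spike hLF hL hC he _ _ hk, if_pos hj₀, Function.comp]
  · have hne : cfg.topLevel b j ≠ n₀ := fun h => hj (cfg.topLevel_inj.1 (h.trans hj₀.symm)).2
    refine Multiset.sum_eq_zero fun g hg => ?_
    obtain ⟨t, -, rfl⟩ := Multiset.mem_map.1 hg
    rw [clippedGrad_spike hLF hL hC he _ _ hk, if_neg hne, zero_smul]

theorem epoch_spike_map_inner (S : BottomLevel) (hLF : 0 < cfg.LF) (hL : cfg.LF ≤ cfg.L)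
    (hΛ : 0 < cfg.batchSize) (hC : 0 < cfg.C) {e : Params cfg.D} (he : ‖e‖ = 1)
    (t₀ : Fin cfg.L) {k : ℝ} (hk : |k| ≤ cfg.C) (v : ℤˣ) {b : Fin (cfg.numSteps lam)}
    {j₀ : Fin (cfg.seqsPerBatch lam)} {n₀ : Fin cfg.N} (hj₀ : cfg.topLevel b j₀ = n₀) :
    (cfg.epoch lam S (weightModel hLF e (spikeWeight hLF n₀ cfg.C k)) (spikeDataset n₀ t₀ v)).map
      (fun o => cfg.batchSize * ⟪e, o b⟫) =
    contributionLaw (S.sample cfg.T lam) (cfg.σ * cfg.C)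
      (extremalGrad (cfg.startsCovering t₀) k ((v : ℤ) * cfg.C)) := by
  have hinner : MeasurePreserving (fun z : Params cfg.D => ⟪e, z⟫) (stdGaussian _)
      (stdGaussian ℝ) := ⟨by fun_prop, map_inner_stdGaussian he⟩
  have hproj : MeasurePreserving
      (fun ω : Fin (cfg.numSteps lam) → cfg.StepRandomness lam =>
        ((ω b).1 j₀, ⟪e, (ω b).2⟫))
      (Measure.pi fun _ => cfg.stepRandomnessLaw lam S)
      ((S.sample cfg.T lam).toMeasure.prod (stdGaussian ℝ)) :=
    ((measurePreserving_eval (fun _ => (S.sample cfg.T lam).toMeasure) j₀).prod hinner).comp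
      (measurePreserving_eval (fun _ => cfg.stepRandomnessLaw lam S) b)
  have hΛ' : (cfg.batchSize : ℝ) ≠ 0 := by exact_mod_cast hΛ.ne'
  rw [epoch, Measure.map_map (by fun_prop) (cfg.measurable_output _ _), contributionLaw,
    ← hproj.map_eq, Measure.map_map (measurable_sum_map_add_smul _ _) hproj.measurable]
  congr 1
  ext1 ω
  simp only [Function.comp, output, noisyGradient_eq,
    sum_clippedGrad_spike hLF hL hC he t₀ hk v hj₀]
  simp only [inner_smul_right, inner_add_right, real_inner_self_eq_norm_sq, he, smul_eq_mul]
  field_simp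

theorem hockeyStick_extremal_le_privacyProfile (S : BottomLevel) (hLF : 0 < cfg.LF)
    (hL : cfg.LF ≤ cfg.L) (hC : 0 < cfg.C) (hD : 0 < cfg.D) (t₀ : Fin cfg.L) {k : ℝ}
    (hk : |k| ≤ cfg.C) (hb : 0 < cfg.numSteps lam) (hj : 0 < cfg.seqsPerBatch lam) (α : ℝ≥0) :
    hockeyStick α
      (contributionLaw (S.sample cfg.T lam) (cfg.σ * cfg.C)
        (extremalGrad (cfg.startsCovering t₀) k cfg.C))
      (contributionLaw (S.sample cfg.T lam) (cfg.σ * cfg.C)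
        (extremalGrad (cfg.startsCovering t₀) k (-cfg.C))) ≤
      privacyProfile (cfg.epoch lam S) EventNeighboring α := by
  have hΛ : 0 < cfg.batchSize := (Nat.div_pos_iff.1 hj).1.trans_le (Nat.div_pos_iff.1 hj).2
  have he : ‖(EuclideanSpace.single ⟨0, hD⟩ 1 : Params cfg.D)‖ = 1 := by simp
  have hpos := epoch_spike_map_inner S hLF hL hΛ hC he t₀ hk 1 (b := ⟨0, hb⟩) (j₀ := ⟨0, hj⟩) rfl
  have hneg := epoch_spike_map_inner S hLF hL hΛ hC he t₀ hk (-1) (b := ⟨0, hb⟩) (j₀ := ⟨0, hj⟩) rfl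
  simp only [Units.val_one, Int.cast_one, one_mul, Units.val_neg, Int.cast_neg, neg_one_mul]
    at hpos hneg
  rw [← hpos, ← hneg]
  exact (hockeyStick_map_le (by fun_prop)).trans
    (hockeyStick_le_privacyProfile _ (eventNeighboring_spikeDataset _ t₀))

end EpochConfig

end ExtremalInstance

/-! ### Comparison of the privacy profiles -/

namespace EpochConfig

variable {cfg : EpochConfig} {lam : ℕ} {S : BottomLevel}

theorem one_sub_le_privacyProfile {x x' : Dataset cfg.N cfg.L} (hx : EventNeighboring x x')
    (m : ForecastModel cfg.D cfg.LC cfg.LF) (α : ℝ≥0) :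
    1 - (α : ℝ≥0∞) ≤ privacyProfile (cfg.epoch lam S) EventNeighboring α :=
  (one_sub_le_hockeyStick α _ _).trans (hockeyStick_le_privacyProfile m hx)

theorem numSteps_mono {lam' : ℕ} (h : lam ≤ lam') : cfg.numSteps lam ≤ cfg.numSteps lam' :=
  Nat.div_le_div_right (Nat.mul_le_mul_left _ h)

theorem hockeyStick_epoch_one_le (hLF : 0 < cfg.LF) (hL : cfg.LF ≤ cfg.L) (hσ : cfg.σ ≠ 0)
    (hC : 0 < cfg.C) (hD : 0 < cfg.D) {α : ℝ≥0} (hα : 0 < α)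
    (hlam : lam ∈ Set.Icc 1 cfg.batchSize) (m : ForecastModel cfg.D cfg.LC cfg.LF)
    {x x' : Dataset cfg.N cfg.L} {n : Fin cfg.N} {t₀ : Fin cfg.L}
    (hxn : ∀ s, s ≠ t₀ → x n s = x' n s) (hx : ∀ k, k ≠ n → x k = x' k)
    {b : Fin (cfg.numSteps 1)} {j : Fin (cfg.seqsPerBatch 1)} (hbj : cfg.topLevel b j = n) :
    hockeyStick α (cfg.epoch 1 S m x) (cfg.epoch 1 S m x') ≤
      privacyProfile (cfg.epoch lam S) EventNeighboring α := by
  obtain ⟨k, hk, hextremal⟩ := exists_hockeyStick_contributionLaw_le (E := Params cfg.D) S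
    (startsCovering_nonempty hLF hL t₀) hα hC (mul_ne_zero hσ hC.ne') hlam.1
  exact (hockeyStick_epoch_le hC hxn hx hbj hextremal).trans
    (hockeyStick_extremal_le_privacyProfile S hLF hL hC hD t₀ hk
      (b.pos.trans_le (numSteps_mono hlam.1)) (Nat.div_pos hlam.2 hlam.1) α)

end EpochConfig

end StructuredSubsampling

end

open StructuredSubsampling in
theorem theorem4p1_general (cfg : EpochConfig) (S : BottomLevel) (hLF : 0 < cfg.LF)
    (hL : cfg.LF ≤ cfg.L) (hσ : cfg.σ ≠ 0) (hC : 0 < cfg.C) (α : ℝ≥0) :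
    IsMinOn (fun lam => privacyProfile (cfg.epoch lam S) EventNeighboring α)
      (Set.Icc 1 cfg.batchSize) 1 := by
  refine isMinOn_iff.2 fun lam hlam => ?_
  refine iSup_le fun m => iSup_le fun x => iSup_le fun x' => iSup_le fun hx => ?_
  have hmin : 1 - (α : ℝ≥0∞) ≤ privacyProfile (cfg.epoch lam S) EventNeighboring α :=
    EpochConfig.one_sub_le_privacyProfile hx m α
  have hequal (h : cfg.epoch 1 S m x = cfg.epoch 1 S m x') :
      hockeyStick α (cfg.epoch 1 S m x) (cfg.epoch 1 S m x') ≤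
        privacyProfile (cfg.epoch lam S) EventNeighboring α :=
    h ▸ (hockeyStick_self_le α _).trans hmin
  obtain ⟨n, t₀, -, hxn, hx'⟩ := hx
  rcases eq_zero_or_pos α with rfl | hα
  · exact (hockeyStick_le_one 0 _ _).trans (by simpa using hmin)
  rcases Nat.eq_zero_or_pos cfg.D with hD | hD
  · have : IsEmpty (Fin cfg.D) := by rw [hD]; infer_instance
    exact hequal (congrArg (Measure.map · _) (Subsingleton.elim _ _))
  by_cases hn : ∃ (b : Fin (cfg.numSteps 1)) (j : Fin (cfg.seqsPerBatch 1)), cfg.topLevel b j = n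
  · obtain ⟨b, j, hbj⟩ := hn
    exact EpochConfig.hockeyStick_epoch_one_le hLF hL hσ hC hD hα hlam m hxn hx' hbj
  · push Not at hn
    exact hequal (EpochConfig.epoch_congr_of_unused hx' hn)

open StructuredSubsampling in
theorem theorem4p1 (cfg : EpochConfig) (S : BottomLevel)
    (hLC : 0 < cfg.LC) (hLF : 0 < cfg.LF) (hL : cfg.LC + cfg.LF + cfg.LF ≤ cfg.L + 1)
    (hΛ : 0 < cfg.batchSize) (hσ : 0 < cfg.σ) (hC : 0 < cfg.C) (hη : 0 < cfg.η)
    {Ω : ℕ → Type*} [∀ lam, MeasurableSpace (Ω lam)] (P Q : ∀ lam, Measure (Ω lam))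
    (hPQ : ∀ lam ∈ Set.Icc 1 cfg.batchSize,
      IsTightDominatingPair (cfg.epoch lam S) EventNeighboring (P lam) (Q lam)) :
    ∀ α : ℝ≥0,
      IsMinOn (fun lam => hockeyStick α (P lam) (Q lam)) (Set.Icc 1 cfg.batchSize) 1 := by
  refine fun α => isMinOn_iff.2 fun lam hlam => ?_
  rw [← (hPQ 1 ⟨le_rfl, hΛ⟩).2.2 α, ← (hPQ lam hlam).2.2 α]
  exact isMinOn_iff.1 (theorem4p1_general cfg S hLF (by omega) hσ.ne' hC α) lam hlam
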